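/- Let $\mathfrak h_3$ be the Siegel upper half space of symmetric complex $3\times 3$ matrices $Z=X+iY$ with $Y$ positive definite; it is the moduli space attached to the cubic Jordan algebra $J=\mathrm{Herm}_3(\mathbb R)$ with norm $\det$. For $N\ge 1$ let $X(N)=\mathfrak h_3/\Gamma(N)$ be the moduli space of principally polarized abelian threefolds with level $N$ structure, where $\Gamma(N)\subset \mathrm{Sp}_6(\mathbb Z)$ is the principal congruence subgroup, and let $X(N)(\mathbb R)\subset X(N)$ be the fixed point set of the involution induced by $Z\mapsto -\bar Z$; $X(4)(\mathbb R)$ is the Goresky–Tai moduli space of real abelian threefolds with level $4$ structure. For a charge vector $\gamma=(p^I,q_I)\in V_J=\mathbb R\oplus J\oplus J^\vee\oplus\mathbb R$ let $$V_{\rm eff}=e^{K}\big(g^{i\bar\jmath}D_i\mathcal Z\,\overline{D_j\mathcal Z}+|\mathcal Z|^2\big)$$ be the effective potential on $\mathfrak h_3$. Here $t^i$ are the entries of $Z$ on and above the diagonal, $F=\det(X^i)/X^0$ is the prepotential, $\Omega=(X^I,\partial F/\partial X^I)$ with $X^0=1$, $X^i=t^i$; the symplectic form is $\langle(p,q),(p',q')\rangle=\sum_I(p^Iq'_I-q_Ip'^I)$,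 and $\mathcal Z=\langle\gamma,\Omega\rangle$, $e^{-K}=i\langle\Omega,\bar\Omega\rangle$, $D_i\mathcal Z=\partial_i\mathcal Z+(\partial_iK)\mathcal Z$, $g_{i\bar\jmath}=\partial_i\partial_{\bar\jmath}K$. The attractor locus of $\gamma$ is the set of critical points of $V_{\rm eff}$. **Proposition.** Let $Q=(p^0,0,q_0,0)$ with $p^0,q_0$ nonzero real numbers (so that $Q$ is non-BPS). 1. The attractor locus of $Q$ is $\mathcal C_Q=\{\,iY\in\mathfrak h_3 : \det Y=|q_0/p^0|\,\}$. 2. The image of $\mathcal C_Q$ in $X(4)$ is contained in $X(4)(\mathbb R)$ and is a smooth submanifold of real codimension $1$ in it: near each of its points, $X(4)(\mathbb R)$ is a smooth $6$-dimensional submanifold of $X(4)$, with local coordinates $v_0,\dots,v_5$ in which the image of $\mathcal C_Q$ is given by $v_0=0$. 3. The image of $\mathcal C_Q$ in $X(1)=\mathfrak h_3/\mathrm{Sp}_6(\mathbb Z)$ is contained in a single connected component of the image of $X(4)(\mathbb R)$ in $X(1)$. -/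

import Mathlib

open scoped ContDiff Matrix

noncomputable section

namespace SiegelAttractor

/-! ## The Siegel upper half space and the action of the integral symplectic group -/

/-- The Siegel upper half space of degree `n`: symmetric complex `n × n` matrices whose imaginary
part is positive definite, with the subspace topology. -/
abbrev Siegel (n : ℕ) : Type :=
  {Z : Matrix (Fin n) (Fin n) ℂ // Z.IsSymm ∧ (Z.map Complex.im).PosDef}

/-- The integral symplectic group `Sp(2n, ℤ)`. -/
abbrev Sp (n : ℕ) : Type := Matrix.symplecticGroup (Fin n) ℤ

/-- The complexification of an integral symplectic matrix. -/
def cplx {n : ℕ} (g : Sp n) : Matrix (Fin n ⊕ Fin n) (Fin n ⊕ Fin n) ℂ :=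
  g.1.map (Int.castRingHom ℂ)

/-- `A Z + B`, where `g = (A B; C D)`. -/
def num {n : ℕ} (g : Sp n) (Z : Matrix (Fin n) (Fin n) ℂ) : Matrix (Fin n) (Fin n) ℂ :=
  (cplx g).toBlocks₁₁ * Z + (cplx g).toBlocks₁₂

/-- `C Z + D`, where `g = (A B; C D)`. -/
def den {n : ℕ} (g : Sp n) (Z : Matrix (Fin n) (Fin n) ℂ) : Matrix (Fin n) (Fin n) ℂ :=
  (cplx g).toBlocks₂₁ * Z + (cplx g).toBlocks₂₂

/-- The `2n × n` matrix with blocks `P` and `R`. -/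
def col {n : ℕ} (P R : Matrix (Fin n) (Fin n) ℂ) : Matrix (Fin n ⊕ Fin n) (Fin n) ℂ :=
  Matrix.fromRows P R

theorem cplx_mul {n : ℕ} (g h : Sp n) : cplx (g * h) = cplx g * cplx h := by
  simp only [cplx, Submonoid.coe_mul, Matrix.map_mul]

theorem cplx_one {n : ℕ} : cplx (1 : Sp n) = 1 := by
  simp [cplx]

theorem cplx_mem {n : ℕ} (g : Sp n) : cplx g ∈ Matrix.symplecticGroup (Fin n) ℂ :=
  SymplecticGroup.map_mem g.2 (Int.castRingHom ℂ)

theorem cplx_conjTranspose {n : ℕ} (g : Sp n) : (cplx g)ᴴ = (cplx g)ᵀ := by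
  ext i j
  simp [cplx, Matrix.conjTranspose_apply]

theorem cplx_mul_col {n : ℕ} (g : Sp n) (Z : Matrix (Fin n) (Fin n) ℂ) :
    cplx g * col Z 1 = col (num g Z) (den g Z) := by
  conv_lhs => rw [← Matrix.fromBlocks_toBlocks (cplx g)]
  rw [col, Matrix.fromBlocks_mul_fromRows]
  simp [num, den, col]

theorem col_mul {n : ℕ} (P R S : Matrix (Fin n) (Fin n) ℂ) :
    col P R * S = col (P * S) (R * S) :=
  Matrix.fromRows_mul P R S

theorem transpose_J_col {n : ℕ} (P R P' R' : Matrix (Fin n) (Fin n) ℂ) :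
    (col P R)ᵀ * Matrix.J (Fin n) ℂ * col P' R' = Rᵀ * P' - Pᵀ * R' := by
  rw [col, col, Matrix.transpose_fromRows, Matrix.J, Matrix.fromCols_mul_fromBlocks,
    Matrix.fromCols_mul_fromRows]
  simp [sub_eq_add_neg]

theorem conjTranspose_J_col {n : ℕ} (P R P' R' : Matrix (Fin n) (Fin n) ℂ) :
    (col P R)ᴴ * Matrix.J (Fin n) ℂ * col P' R' = Rᴴ * P' - Pᴴ * R' := by
  rw [col, col, Matrix.conjTranspose_fromRows_eq_fromCols_conjTranspose, Matrix.J,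
    Matrix.fromCols_mul_fromBlocks, Matrix.fromCols_mul_fromRows]
  simp [sub_eq_add_neg]

theorem den_transpose_mul_num {n : ℕ} (g : Sp n) (Z : Matrix (Fin n) (Fin n) ℂ) :
    (den g Z)ᵀ * num g Z - (num g Z)ᵀ * den g Z = Z - Zᵀ := by
  rw [← transpose_J_col, ← cplx_mul_col, Matrix.transpose_mul]
  have h := SymplecticGroup.mem_iff'.1 (cplx_mem g)
  calc _ = (col Z 1)ᵀ * ((cplx g)ᵀ * Matrix.J (Fin n) ℂ * cplx g) * col Z 1 := by
        simp only [Matrix.mul_assoc]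
    _ = _ := by rw [h, transpose_J_col]; simp

theorem den_conjTranspose_mul_num {n : ℕ} (g : Sp n) (Z : Matrix (Fin n) (Fin n) ℂ) :
    (den g Z)ᴴ * num g Z - (num g Z)ᴴ * den g Z = Z - Zᴴ := by
  rw [← conjTranspose_J_col, ← cplx_mul_col, Matrix.conjTranspose_mul, cplx_conjTranspose]
  have h := SymplecticGroup.mem_iff'.1 (cplx_mem g)
  calc _ = (col Z 1)ᴴ * ((cplx g)ᵀ * Matrix.J (Fin n) ℂ * cplx g) * col Z 1 := by
        simp only [Matrix.mul_assoc]
    _ = _ := by rw [h, conjTranspose_J_col]; simp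

theorem sub_conjTranspose_of_isSymm {n : ℕ} {Z : Matrix (Fin n) (Fin n) ℂ} (h : Z.IsSymm) :
    Z - Zᴴ = (2 * Complex.I) • (Z.map Complex.im).map Complex.ofReal := by
  ext i j
  have h' : Z j i = Z i j := h.apply i j
  simp only [Matrix.sub_apply, Matrix.conjTranspose_apply, h', Matrix.smul_apply, Matrix.map_apply,
    smul_eq_mul]
  apply Complex.ext <;> simp
  ring

theorem isSymm_map_im {n : ℕ} {Z : Matrix (Fin n) (Fin n) ℂ} (h : Z.IsSymm) :
    (Z.map Complex.im).IsSymm := by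
  ext i j
  simp [h.apply i j]

theorem star_dotProduct_map_ofReal {n : ℕ} {Y : Matrix (Fin n) (Fin n) ℝ} (h : Y.IsSymm)
    (v : Fin n → ℂ) : star v ⬝ᵥ (Y.map Complex.ofReal *ᵥ v) =
      (((fun i => (v i).re) ⬝ᵥ (Y *ᵥ fun i => (v i).re) +
        (fun i => (v i).im) ⬝ᵥ (Y *ᵥ fun i => (v i).im) : ℝ) : ℂ) := by
  have key : ∑ i, ∑ j, (v i).re * (Y i j * (v j).im) = ∑ i, ∑ j, (v i).im * (Y i j * (v j).re) := by
    rw [Finset.sum_comm]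
    refine Finset.sum_congr rfl fun i _ => Finset.sum_congr rfl fun j _ => ?_
    rw [h.apply i j]; ring
  simp only [dotProduct, Matrix.mulVec, Matrix.map_apply, Pi.star_apply, RCLike.star_def,
    Finset.mul_sum]
  apply Complex.ext
  · simp [Finset.sum_add_distrib]
  · simp only [Complex.im_sum, Complex.ofReal_im]
    simp only [Complex.mul_im, Complex.conj_re, Complex.conj_im, Complex.mul_re, Complex.ofReal_re,
      Complex.ofReal_im, zero_mul, sub_zero, add_zero, neg_mul, Finset.sum_add_distrib,
      Finset.sum_neg_distrib, key]
    ring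

theorem star_dotProduct_map_ofReal_pos {n : ℕ} {Y : Matrix (Fin n) (Fin n) ℝ} (h : Y.IsSymm)
    (hY : Y.PosDef) {v : Fin n → ℂ} (hv : v ≠ 0) :
    0 < (star v ⬝ᵥ (Y.map Complex.ofReal *ᵥ v)).re := by
  rw [star_dotProduct_map_ofReal h, Complex.ofReal_re]
  have hnn : ∀ w : Fin n → ℝ, 0 ≤ w ⬝ᵥ (Y *ᵥ w) := fun w => by
    simpa using hY.posSemidef.dotProduct_mulVec_nonneg w
  have hpos : ∀ w : Fin n → ℝ, w ≠ 0 → 0 < w ⬝ᵥ (Y *ᵥ w) := fun w hw => by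
    simpa using hY.dotProduct_mulVec_pos hw
  by_cases hre : (fun i => (v i).re) = 0
  · have him : (fun i => (v i).im) ≠ 0 := fun h0 =>
      hv (funext fun i => Complex.ext (congrFun hre i) (congrFun h0 i))
    exact add_pos_of_nonneg_of_pos (hnn _) (hpos _ him)
  · exact add_pos_of_pos_of_nonneg (hpos _ hre) (hnn _)

theorem isUnit_den {n : ℕ} (g : Sp n) (Z : Siegel n) : IsUnit (den g Z.1) := by
  rw [← Matrix.mulVec_injective_iff_isUnit]
  intro v w hvw
  by_contra hne
  have hu : v - w ≠ 0 := sub_ne_zero.2 hne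
  have h0 : den g Z.1 *ᵥ (v - w) = 0 := by
    rw [Matrix.mulVec_sub]; exact sub_eq_zero.2 hvw
  have h1 := congrArg (fun M => star (v - w) ⬝ᵥ (M *ᵥ (v - w))) (den_conjTranspose_mul_num g Z.1)
  simp only [Matrix.sub_mulVec, dotProduct_sub, ← Matrix.mulVec_mulVec, h0, Matrix.mulVec_zero,
    sub_zero] at h1
  rw [Matrix.dotProduct_mulVec, ← Matrix.star_mulVec, h0, star_zero, zero_dotProduct,
    ← dotProduct_sub, ← Matrix.sub_mulVec, sub_conjTranspose_of_isSymm Z.2.1,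
    Matrix.smul_mulVec, dotProduct_smul] at h1
  have h2 := star_dotProduct_map_ofReal_pos (isSymm_map_im Z.2.1) Z.2.2 hu
  have h3 : (2 * Complex.I) ≠ 0 := by simp
  rw [(smul_eq_zero.1 h1.symm).resolve_left h3] at h2
  simp at h2

theorem isSymm_num_mul_inv_den {n : ℕ} (g : Sp n) (Z : Siegel n) :
    (num g Z.1 * (den g Z.1)⁻¹).IsSymm := by
  have hu : IsUnit (den g Z.1).det := (Matrix.isUnit_iff_isUnit_det _).1 (isUnit_den g Z)
  have hu' : IsUnit (den g Z.1)ᵀ.det := by rwa [Matrix.det_transpose]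
  have h := den_transpose_mul_num g Z.1
  rw [Z.2.1, sub_self, sub_eq_zero] at h
  rw [Matrix.IsSymm, Matrix.transpose_mul, Matrix.transpose_nonsing_inv]
  calc (den g Z.1)ᵀ⁻¹ * (num g Z.1)ᵀ
      = (den g Z.1)ᵀ⁻¹ * ((num g Z.1)ᵀ * den g Z.1) * (den g Z.1)⁻¹ := by
        rw [← Matrix.mul_assoc, Matrix.mul_nonsing_inv_cancel_right _ _ hu]
    _ = _ := by rw [← h, ← Matrix.mul_assoc, Matrix.nonsing_inv_mul _ hu', Matrix.one_mul]

theorem posDef_num_mul_inv_den {n : ℕ} (g : Sp n) (Z : Siegel n) :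
    ((num g Z.1 * (den g Z.1)⁻¹).map Complex.im).PosDef := by
  have hu : IsUnit (den g Z.1).det := (Matrix.isUnit_iff_isUnit_det _).1 (isUnit_den g Z)
  set W := num g Z.1 * (den g Z.1)⁻¹ with hW
  have hWs : W.IsSymm := isSymm_num_mul_inv_den g Z
  have hWd : W * den g Z.1 = num g Z.1 := by
    rw [hW, Matrix.nonsing_inv_mul_cancel_right _ _ hu]
  clear_value W
  have h := den_conjTranspose_mul_num g Z.1
  rw [← hWd, Matrix.conjTranspose_mul, Matrix.mul_assoc, ← Matrix.mul_sub, ← Matrix.sub_mul,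
    sub_conjTranspose_of_isSymm hWs, sub_conjTranspose_of_isSymm Z.2.1, Matrix.smul_mul,
    Matrix.mul_smul] at h
  have h3 : (2 * Complex.I) ≠ 0 := by simp
  have h4 := smul_right_injective _ h3 h
  refine Matrix.PosDef.of_dotProduct_mulVec_pos
    (by ext i j; simpa using (isSymm_map_im hWs).apply i j) fun x hx => ?_
  let y : Fin n → ℂ := fun i => (x i : ℂ)
  have hy : y ≠ 0 := fun h0 => hx (funext fun i => by simpa [y] using congrFun h0 i)
  have hdv : den g Z.1 *ᵥ ((den g Z.1)⁻¹ *ᵥ y) = y := by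
    rw [Matrix.mulVec_mulVec, Matrix.mul_nonsing_inv _ hu, Matrix.one_mulVec]
  set v := (den g Z.1)⁻¹ *ᵥ y with hv
  have hv0 : v ≠ 0 := fun h0 => hy (by rw [← hdv, h0, Matrix.mulVec_zero])
  have h5 := star_dotProduct_map_ofReal_pos (isSymm_map_im Z.2.1) Z.2.2 hv0
  rw [← h4, ← Matrix.mulVec_mulVec, ← Matrix.mulVec_mulVec, hdv, Matrix.dotProduct_mulVec,
    ← Matrix.star_mulVec, hdv, star_dotProduct_map_ofReal (isSymm_map_im hWs)] at h5
  simpa [y, dotProduct, Matrix.mulVec] using h5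

theorem num_den_mul {n : ℕ} (g h : Sp n) (Z : Siegel n) :
    num (g * h) Z.1 = num g (num h Z.1 * (den h Z.1)⁻¹) * den h Z.1 ∧
      den (g * h) Z.1 = den g (num h Z.1 * (den h Z.1)⁻¹) * den h Z.1 := by
  have hu : IsUnit (den h Z.1).det := (Matrix.isUnit_iff_isUnit_det _).1 (isUnit_den h Z)
  have e : col (num (g * h) Z.1) (den (g * h) Z.1) =
      col (num g (num h Z.1 * (den h Z.1)⁻¹) * den h Z.1)
        (den g (num h Z.1 * (den h Z.1)⁻¹) * den h Z.1) := by
    rw [← col_mul, ← cplx_mul_col, ← cplx_mul_col, cplx_mul, Matrix.mul_assoc, Matrix.mul_assoc,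
      cplx_mul_col, col_mul, Matrix.nonsing_inv_mul_cancel_right _ _ hu, Matrix.one_mul]
  exact ⟨congrArg Matrix.toRows₁ e, congrArg Matrix.toRows₂ e⟩

/-- The action `(A B; C D) • Z = (A Z + B) (C Z + D)⁻¹` of `Sp(2n, ℤ)` on the Siegel space. -/
instance (n : ℕ) : MulAction (Sp n) (Siegel n) where
  smul g Z := ⟨num g Z.1 * (den g Z.1)⁻¹, isSymm_num_mul_inv_den g Z, posDef_num_mul_inv_den g Z⟩
  one_smul Z := Subtype.ext (by
    change num 1 Z.1 * (den 1 Z.1)⁻¹ = Z.1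
    have e : col (num 1 Z.1) (den 1 Z.1) = col Z.1 1 := by
      rw [← cplx_mul_col, cplx_one, Matrix.one_mul]
    rw [show num 1 Z.1 = Z.1 from congrArg Matrix.toRows₁ e,
      show den 1 Z.1 = 1 from congrArg Matrix.toRows₂ e, inv_one, Matrix.mul_one])
  mul_smul g h Z := Subtype.ext (by
    have hu : IsUnit (den h Z.1).det := (Matrix.isUnit_iff_isUnit_det _).1 (isUnit_den h Z)
    change num (g * h) Z.1 * (den (g * h) Z.1)⁻¹ =
      num g (num h Z.1 * (den h Z.1)⁻¹) * (den g (num h Z.1 * (den h Z.1)⁻¹))⁻¹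
    rw [(num_den_mul g h Z).1, (num_den_mul g h Z).2, Matrix.mul_inv_rev, ← Matrix.mul_assoc,
      Matrix.mul_nonsing_inv_cancel_right _ _ hu])

/-! ## Moduli of principally polarized abelian varieties and real points -/

/-- The principal congruence subgroup `Γ(N)` of `Sp(2n, ℤ)`. -/
def Gam (n N : ℕ) : Subgroup (Sp n) where
  carrier := {g | g.1.map (Int.castRingHom (ZMod N)) = 1}
  one_mem' := by simp
  mul_mem' {g h} hg hh := by
    simp only [Set.mem_ofPred_eq, Submonoid.coe_mul, Matrix.map_mul] at *
    rw [hg, hh, Matrix.one_mul]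
  inv_mem' {g} hg := by
    simp only [Set.mem_ofPred_eq] at *
    have h := congrArg (fun M => M.map (Int.castRingHom (ZMod N)))
      (congrArg Subtype.val (mul_inv_cancel g))
    simp only [Submonoid.coe_mul, Matrix.map_mul, hg, Matrix.one_mul] at h
    rw [h]; simp

/-- `X(N) = 𝔥_n / Γ(N)`, the moduli space of principally polarized abelian `n`-folds with full
level `N` structure, with the quotient topology. -/
abbrev X (n N : ℕ) : Type := Quotient (MulAction.orbitRel (Gam n N) (Siegel n))

/-- The quotient map `𝔥_n → X(N)`. -/
def proj (n N : ℕ) (Z : Siegel n) : X n N := Quotient.mk _ Z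

/-- The natural map `X(N) → X(1)` forgetting the level structure. -/
def forget (n N : ℕ) : X n N → X n 1 :=
  Quotient.map' id (by
    rintro Z W ⟨g, rfl⟩
    refine ⟨⟨g.1, ?_⟩, rfl⟩
    ext i j
    exact Subsingleton.elim (α := ZMod 1) _ _)

/-- The antiholomorphic involution `Z ↦ -Z̄` of the Siegel space. -/
def tau {n : ℕ} (Z : Siegel n) : Siegel n :=
  ⟨-Z.1.map (starRingEnd ℂ), by
    ext i j
    simp [Z.2.1.apply i j], by
    have h : (-Z.1.map (starRingEnd ℂ)).map Complex.im = Z.1.map Complex.im := by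
      ext i j; simp
    rw [h]; exact Z.2.2⟩

/-- Conjugation by `diag(-1, 1)`: the matrix `(A B; C D)` is sent to `(A -B; -C D)`. -/
def sigma {n : ℕ} (g : Sp n) : Sp n :=
  ⟨Matrix.fromBlocks (-1) 0 0 1 * g.1 * Matrix.fromBlocks (-1) 0 0 1, by
    have hE : (Matrix.fromBlocks (-1) 0 0 1 : Matrix (Fin n ⊕ Fin n) (Fin n ⊕ Fin n) ℤ)ᵀ =
        Matrix.fromBlocks (-1) 0 0 1 := by
      rw [Matrix.fromBlocks_transpose]; simp
    have hJ : (Matrix.fromBlocks (-1) 0 0 1 : Matrix (Fin n ⊕ Fin n) (Fin n ⊕ Fin n) ℤ) *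
        Matrix.J (Fin n) ℤ * Matrix.fromBlocks (-1) 0 0 1 = -Matrix.J (Fin n) ℤ := by
      simp [Matrix.J, Matrix.fromBlocks_multiply, Matrix.fromBlocks_neg]
    have hg := SymplecticGroup.mem_iff.1 g.2
    rw [SymplecticGroup.mem_iff, Matrix.transpose_mul, Matrix.transpose_mul, hE]
    generalize (Matrix.fromBlocks (-1) 0 0 1 : Matrix (Fin n ⊕ Fin n) (Fin n ⊕ Fin n) ℤ) = E at *
    calc E * g.1 * E * Matrix.J (Fin n) ℤ * (E * (g.1ᵀ * E))
        = E * (g.1 * (E * Matrix.J (Fin n) ℤ * E) * g.1ᵀ) * E := by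
          simp only [Matrix.mul_assoc]
      _ = _ := by
          rw [hJ, Matrix.mul_neg, Matrix.neg_mul, hg, Matrix.mul_neg, Matrix.neg_mul, hJ, neg_neg]⟩

theorem num_den_sigma {n : ℕ} (g : Sp n) (Z : Matrix (Fin n) (Fin n) ℂ) :
    num (sigma g) (-Z.map (starRingEnd ℂ)) = -(num g Z).map (starRingEnd ℂ) ∧
      den (sigma g) (-Z.map (starRingEnd ℂ)) = (den g Z).map (starRingEnd ℂ) := by
  have hc : ∀ a b, starRingEnd ℂ (cplx g a b) = cplx g a b := fun a b => by simp [cplx]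
  have e : cplx (sigma g) = Matrix.fromBlocks (cplx g).toBlocks₁₁ (-(cplx g).toBlocks₁₂)
      (-(cplx g).toBlocks₂₁) (cplx g).toBlocks₂₂ := by
    have h1 : (sigma g).1 = Matrix.fromBlocks g.1.toBlocks₁₁ (-g.1.toBlocks₁₂)
        (-g.1.toBlocks₂₁) g.1.toBlocks₂₂ := by
      change Matrix.fromBlocks (-1) 0 0 1 * g.1 * Matrix.fromBlocks (-1) 0 0 1 = _
      conv_lhs => rw [← Matrix.fromBlocks_toBlocks g.1]
      simp [Matrix.fromBlocks_multiply]
    rw [cplx, h1, Matrix.fromBlocks_map]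
    ext a b
    rcases a with a | a <;> rcases b with b | b <;>
      simp [cplx, Matrix.toBlocks₁₁, Matrix.toBlocks₁₂, Matrix.toBlocks₂₁, Matrix.toBlocks₂₂]
  constructor
  · rw [num, num, e]
    ext i j
    simp [Matrix.mul_apply, Matrix.toBlocks₁₁, Matrix.toBlocks₁₂, hc]
    ring
  · rw [den, den, e]
    ext i j
    simp [Matrix.mul_apply, Matrix.toBlocks₂₁, Matrix.toBlocks₂₂, hc]

theorem tau_smul {n : ℕ} (g : Sp n) (Z : Siegel n) : tau (g • Z) = sigma g • tau Z := by
  apply Subtype.ext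
  change -(num g Z.1 * (den g Z.1)⁻¹).map (starRingEnd ℂ) =
    num (sigma g) (-Z.1.map (starRingEnd ℂ)) * (den (sigma g) (-Z.1.map (starRingEnd ℂ)))⁻¹
  have hu : IsUnit (den g Z.1).det := (Matrix.isUnit_iff_isUnit_det _).1 (isUnit_den g Z)
  have hinv : ((den g Z.1)⁻¹).map (starRingEnd ℂ) = ((den g Z.1).map (starRingEnd ℂ))⁻¹ := by
    symm
    apply Matrix.inv_eq_right_inv
    rw [← Matrix.map_mul, Matrix.mul_nonsing_inv _ hu]
    simp
  rw [(num_den_sigma g Z.1).1, (num_den_sigma g Z.1).2, Matrix.map_mul, hinv, Matrix.neg_mul]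

theorem sigma_mem {n N : ℕ} {g : Sp n} (hg : g ∈ Gam n N) : sigma g ∈ Gam n N := by
  have hg' : g.1.map (Int.castRingHom (ZMod N)) = 1 := hg
  change (Matrix.fromBlocks (-1) 0 0 1 * g.1 * Matrix.fromBlocks (-1) 0 0 1).map
    (Int.castRingHom (ZMod N)) = 1
  rw [Matrix.map_mul, Matrix.map_mul, hg', Matrix.mul_one, ← Matrix.map_mul,
    Matrix.fromBlocks_multiply]
  simp

/-- The real structure on `X(N)`: the involution induced by `Z ↦ -Z̄`. -/
def realStructure (n N : ℕ) : X n N → X n N :=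
  Quotient.map' tau (by
    rintro Z W ⟨g, rfl⟩
    exact ⟨⟨sigma g.1, sigma_mem g.2⟩, (tau_smul g.1 W).symm⟩)

/-- The set of real points `X(N)(ℝ)`. For `4 ∣ N` it is the moduli space of principally polarized
real abelian `n`-folds with level `N` structure. -/
def realPoints (n N : ℕ) : Set (X n N) := {x | realStructure n N x = x}

/-- `C` is a smooth submanifold of real codimension one of `S ⊆ X(N)`, where, along `C`, the set
`S` is itself a smooth submanifold of dimension `d`: near each point of `C` there is a chart of `S`,
given by a smooth immersion `s` of an open `V ⊆ ℝ^d` into `𝔥_n` whose composite with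
`𝔥_n → X(N)` is an open embedding of `V` into `S`, in which `C` is the slice `v 0 = 0`. -/
def IsSmoothHypersurface {n N : ℕ} (d : ℕ) [NeZero d] (C S : Set (X n N)) : Prop :=
  C ⊆ S ∧ ∀ x ∈ C, ∃ (V : Set (Fin d → ℝ)) (s : (Fin d → ℝ) → Siegel n)
    (hS : ∀ v ∈ V, proj n N (s v) ∈ S),
    IsOpen V ∧
    (∀ i j, ContDiffOn ℝ ∞ (fun v => (s v).1 i j) V) ∧
    (∀ v ∈ V, ∀ w, (∀ i j, fderiv ℝ (fun v => (s v).1 i j) v w = 0) → w = 0) ∧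
    Topology.IsOpenEmbedding (fun v : V => (⟨proj n N (s v), hS v v.2⟩ : S)) ∧
    (∃ v ∈ V, proj n N (s v) = x) ∧
    ∀ v ∈ V, proj n N (s v) ∈ C ↔ v 0 = 0

/-! ## Special geometry for `J = Herm₃(ℝ)` and the effective potential

Complex coordinates on `J ⊗ ℂ`, the symmetric `3 × 3` matrices, are indexed by `Sym2 (Fin 3)`;
the coordinate `s(i, j)` is the entry at `(i, j)`. The index set `Option (Sym2 (Fin 3))`
adds the index `0`, written `none`. -/

/-- The symmetric matrix with coordinates `t`. -/
def symMatrix {R : Type*} (t : Sym2 (Fin 3) → R) : Matrix (Fin 3) (Fin 3) R :=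
  Matrix.of fun i j => t s(i, j)

/-- The coordinates of a point of the Siegel space. -/
def coords (Z : Siegel 3) : Sym2 (Fin 3) → ℂ :=
  Sym2.lift ⟨fun i j => Z.1 i j, fun i j => Z.2.1.apply j i⟩

/-- Vectors `(p^I, q_I)` of `V_J ⊗ R = R ⊕ J_R ⊕ J_R^∨ ⊕ R`: the first function has components
`p^0, p^i`, the second `q_0, q_i`. -/
abbrev FTS (R : Type*) : Type _ := (Option (Sym2 (Fin 3)) → R) × (Option (Sym2 (Fin 3)) → R)

/-- The symplectic form `⟨(p, q), (p', q')⟩ = ∑ (p^I q'_I - q_I p'^I)`. -/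
def sympl {R : Type*} [CommRing R] (a b : FTS R) : R := ∑ I, (a.1 I * b.2 I - a.2 I * b.1 I)

/-- The prepotential `F(X) = N(X^i) / X^0`, with `N = det` the cubic norm of `J`. -/
def prepotential (x : Option (Sym2 (Fin 3)) → ℂ) : ℂ :=
  (symMatrix fun i => x (some i)).det / x none

/-- The special coordinates `X^0 = 1`, `X^i = t^i`. -/
def specialCoords (t : Sym2 (Fin 3) → ℂ) : Option (Sym2 (Fin 3)) → ℂ
  | none => 1
  | some i => t i

/-- The trivialization `Ω = (X^I, F_I)`, `F_I = ∂F/∂X^I`, of the Hodge line bundle `H^{3,0}`. -/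
def Omega (t : Sym2 (Fin 3) → ℂ) : FTS ℂ :=
  (specialCoords t, fun I => fderiv ℂ prepotential (specialCoords t) (Pi.single I 1))

/-- Componentwise complex conjugation on `V_J ⊗ ℂ`. -/
def conjFTS (a : FTS ℂ) : FTS ℂ := (fun I => starRingEnd ℂ (a.1 I), fun I => starRingEnd ℂ (a.2 I))

/-- The central charge `Z = ⟨γ, Ω⟩` of a real charge vector `γ`. -/
def centralCharge (c : FTS ℝ) (t : Sym2 (Fin 3) → ℂ) : ℂ :=
  sympl (fun I => (c.1 I : ℂ), fun I => (c.2 I : ℂ)) (Omega t)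

/-- The real number `e^{-K} = i ⟨Ω, Ω̄⟩`. -/
def expNegK (t : Sym2 (Fin 3) → ℂ) : ℝ := (Complex.I * sympl (Omega t) (conjFTS (Omega t))).re

/-- The Kähler potential `K`. -/
def kahler (t : Sym2 (Fin 3) → ℂ) : ℂ := ((-Real.log (expNegK t) : ℝ) : ℂ)

/-- The Wirtinger derivative `∂f/∂t^i`. -/
def dHol (i : Sym2 (Fin 3)) (f : (Sym2 (Fin 3) → ℂ) → ℂ) (t : Sym2 (Fin 3) → ℂ) : ℂ :=
  (fderiv ℝ f t (Pi.single i 1) - Complex.I * fderiv ℝ f t (Pi.single i Complex.I)) / 2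

/-- The Wirtinger derivative `∂f/∂t̄^i`. -/
def dAnti (i : Sym2 (Fin 3)) (f : (Sym2 (Fin 3) → ℂ) → ℂ) (t : Sym2 (Fin 3) → ℂ) : ℂ :=
  (fderiv ℝ f t (Pi.single i 1) + Complex.I * fderiv ℝ f t (Pi.single i Complex.I)) / 2

/-- The covariant derivative `D_i Z = ∂_i Z + (∂_i K) Z`. -/
def covDeriv (c : FTS ℝ) (i : Sym2 (Fin 3)) (t : Sym2 (Fin 3) → ℂ) : ℂ :=
  dHol i (centralCharge c) t + dHol i kahler t * centralCharge c t

/-- The Kähler metric `g_{i j̄} = ∂_i ∂_{j̄} K`. -/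
def metric (t : Sym2 (Fin 3) → ℂ) : Matrix (Sym2 (Fin 3)) (Sym2 (Fin 3)) ℂ :=
  Matrix.of fun i j => dHol i (dAnti j kahler) t

/-- The effective (black hole) potential `V_eff = e^K (g^{i j̄} D_i Z conj(D_j Z) + |Z|²)`, where
`g^{i j̄}`, determined by `g^{i j̄} g_{k j̄} = δ^i_k`, is the `(j, i)` entry of the inverse of the
metric. -/
def effPotential (c : FTS ℝ) (t : Sym2 (Fin 3) → ℂ) : ℝ :=
  (expNegK t)⁻¹ * ((∑ i, ∑ j, (metric t)⁻¹ j i * covDeriv c i t *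
    starRingEnd ℂ (covDeriv c j t)).re + ‖centralCharge c t‖ ^ 2)

/-- The attractor locus of the charge `c` in the moduli space `𝔥_3`: the set of critical points of
the effective potential. -/
def attractorLocus (c : FTS ℝ) : Set (Siegel 3) :=
  {Z | HasFDerivAt (effPotential c) (0 : (Sym2 (Fin 3) → ℂ) →L[ℝ] ℝ) (coords Z)}

/-- The charge vector `Q = (p^0, 0, q_0, 0)`. Its quartic invariant is `-(p^0 q_0)²`, so that it is
non-BPS exactly when `p^0` and `q_0` are nonzero. -/
def chargeD0D6 (p0 q0 : ℝ) : FTS ℝ := (Pi.single none p0, Pi.single none q0)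

/-- `C_Q`, for `Q = (p^0, 0, q_0, 0)`: the points `Z = i Y` with `det Y = |q_0 / p^0|`. -/
def locusC (p0 q0 : ℝ) : Set (Siegel 3) :=
  {Z | Z.1.map Complex.re = 0 ∧ (Z.1.map Complex.im).det = |q0 / p0|}

end SiegelAttractor

end

open SiegelAttractor

open Asymptotics Filter Topology

/-! ## Coordinates on symmetric matrices of size three -/

/-! Write `Z = X + iY` and `N = det`. For the charge `(p⁰, 0, q₀, 0)` the effective potential
collapses to `V = (q₀² + 2 p⁰ q₀ N(X) + p⁰² |N(Z)|²) / (2 N(Y))` (`effPotential_chargeD0D6`). The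
point is that the Kähler metric is a trace form `tr(P Eᵢ P Eⱼ)` with `P = (2Y)⁻¹`, so contracting
with its inverse becomes a product of `3 × 3` matrices and no `6 × 6` matrix has to be inverted.

Diagonalize simultaneously: `Y = S Sᵀ`, `X = S diag(d) Sᵀ`, so `N(Z) = (det S)² ∏ (d_k + i)`. At a
critical point, varying each `d_k` gives three equations and varying along the ray through `Z` gives
`q₀² = p⁰² |N(Z)|²`; together they force `d = 0` (`eq_zero_of_attractor_equations`), that is `X =
0`, and then `det Y = |q₀/p⁰|`. Conversely `V ≥ |p⁰ q₀|` on the whole half space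
(`abs_mul_le_effPotential`), with equality on `C_Q`, so points of `C_Q` are minima and hence
critical.

For the image in `X(4)`: `Sp(2n, ℤ)` acts properly discontinuously, so stabilizers are finite, and
an integral matrix of finite order congruent to `1` modulo `4` is `1`. Hence `Γ(4)` acts freely, and
a point fixed by `τ : Z ↦ -Z̄` has a `τ`-stable neighbourhood that meets none of its nontrivial
translates (`exists_slice`). In it a point with real image satisfies `gZ = τZ` with `g = 1`, so near
`C_Q` the real locus is the imaginary cone `{iY}`. There `det Y` can replace the last diagonal entry
as a coordinate. Distant parts of `C_Q` do not spoil the slice: an element of `Γ(4)` that joins two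
points of the cone is block diagonal with unimodular blocks and preserves `det Y`
(`det_im_smul_of_tau`).

For the image in `X(1)`: `C_Q` is the image of the convex cone of positive definite matrices under
radial projection, so it is connected, and it consists of points fixed by `τ`. -/

theorem univ_sym2_fin_three :
    (Finset.univ : Finset (Sym2 (Fin 3))) =
      {s(0, 0), s(0, 1), s(0, 2), s(1, 1), s(1, 2), s(2, 2)} := by decide

theorem sum_sym2_fin_three {M : Type*} [AddCommMonoid M] (f : Sym2 (Fin 3) → M) :
    ∑ i, f i = f s(0, 0) + (f s(0, 1) + (f s(0, 2) + (f s(1, 1) + (f s(1, 2) + f s(2, 2))))) := by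
  rw [univ_sym2_fin_three]
  repeat rw [Finset.sum_insert (by decide)]
  rw [Finset.sum_singleton]

theorem sym2_fin_three_cases {P : Sym2 (Fin 3) → Prop} (h00 : P s(0, 0)) (h01 : P s(0, 1))
    (h02 : P s(0, 2)) (h11 : P s(1, 1)) (h12 : P s(1, 2)) (h22 : P s(2, 2)) (i : Sym2 (Fin 3)) :
    P i := by
  have h : i ∈ (Finset.univ : Finset (Sym2 (Fin 3))) := Finset.mem_univ i
  rw [univ_sym2_fin_three] at h
  simp only [Finset.mem_insert, Finset.mem_singleton] at h
  rcases h with rfl | rfl | rfl | rfl | rfl | rfl <;> assumption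

/-- The cubic norm in coordinates. -/
def nrm {R : Type*} [CommRing R] (t : Sym2 (Fin 3) → R) : R :=
  t s(0, 0) * t s(1, 1) * t s(2, 2) + 2 * t s(0, 1) * t s(0, 2) * t s(1, 2) -
    t s(0, 0) * t s(1, 2) ^ 2 - t s(1, 1) * t s(0, 2) ^ 2 - t s(2, 2) * t s(0, 1) ^ 2

/-- The differential of the cubic norm at `t` in the direction `u`. -/
def nrmDiff {R : Type*} [CommRing R] (t u : Sym2 (Fin 3) → R) : R :=
  (t s(1, 1) * t s(2, 2) - t s(1, 2) ^ 2) * u s(0, 0) +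
  (t s(0, 0) * t s(2, 2) - t s(0, 2) ^ 2) * u s(1, 1) +
  (t s(0, 0) * t s(1, 1) - t s(0, 1) ^ 2) * u s(2, 2) +
  2 * (t s(0, 2) * t s(1, 2) - t s(0, 1) * t s(2, 2)) * u s(0, 1) +
  2 * (t s(0, 1) * t s(1, 2) - t s(0, 2) * t s(1, 1)) * u s(0, 2) +
  2 * (t s(0, 1) * t s(0, 2) - t s(1, 2) * t s(0, 0)) * u s(1, 2)

theorem det_symMatrix {R : Type*} [CommRing R] (t : Sym2 (Fin 3) → R) :
    (symMatrix t).det = nrm t := by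
  have h1 : (s(1, 0) : Sym2 (Fin 3)) = s(0, 1) := Sym2.eq_swap
  have h2 : (s(2, 0) : Sym2 (Fin 3)) = s(0, 2) := Sym2.eq_swap
  have h3 : (s(2, 1) : Sym2 (Fin 3)) = s(1, 2) := Sym2.eq_swap
  simp only [Matrix.det_fin_three, symMatrix, Matrix.of_apply, nrm, h1, h2, h3]
  ring

theorem sum_nrmDiff {R : Type*} [CommRing R] (t u : Sym2 (Fin 3) → R) :
    ∑ i, nrmDiff t (Pi.single i 1) * u i = nrmDiff t u := by
  simp only [sum_sym2_fin_three, nrmDiff, Pi.single_apply]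
  simp [show (s(0, 0) : Sym2 (Fin 3)) ≠ s(0, 1) by decide,
    show (s(0, 0) : Sym2 (Fin 3)) ≠ s(0, 2) by decide]
  ring

theorem hasFDerivAt_nrm {𝕜 : Type*} [NontriviallyNormedField 𝕜] (t : Sym2 (Fin 3) → 𝕜) :
    ∃ L : (Sym2 (Fin 3) → 𝕜) →L[𝕜] 𝕜, HasFDerivAt nrm L t ∧ ∀ u, L u = nrmDiff t u := by
  have h : ∀ i, HasFDerivAt (fun t : Sym2 (Fin 3) → 𝕜 => t i)
    (ContinuousLinearMap.proj (R := 𝕜) (φ := fun _ : Sym2 (Fin 3) => 𝕜) i) t :=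
    fun i => hasFDerivAt_apply i t
  refine ⟨_, ((((((h s(0,0)).mul (h s(1,1))).mul (h s(2,2))).add
    ((((h s(0,1)).const_mul 2).mul (h s(0,2))).mul (h s(1,2)))).sub
    ((h s(0,0)).mul ((h s(1,2)).pow 2))).sub ((h s(1,1)).mul ((h s(0,2)).pow 2))).sub
    ((h s(2,2)).mul ((h s(0,1)).pow 2)), fun u => ?_⟩
  simp [nrmDiff]
  ring

/-! ## Matrix form of the differential and the Hessian of the cubic norm -/

/-- The second differential of the cubic norm at `t`. -/
def nrmHess {R : Type*} [CommRing R] (t u v : Sym2 (Fin 3) → R) : R :=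
  nrmDiff (t + v) u - nrmDiff t u - nrmDiff v u

theorem symMatrix_apply {R : Type*} (t : Sym2 (Fin 3) → R) (i j : Fin 3) :
    symMatrix t i j = t s(i, j) := rfl

theorem symMatrix_isSymm {R : Type*} (t : Sym2 (Fin 3) → R) : (symMatrix t).IsSymm :=
  Matrix.IsSymm.ext fun _ _ => congrArg t Sym2.eq_swap

theorem exists_symMatrix {R : Type*} {M : Matrix (Fin 3) (Fin 3) R} (hM : M.IsSymm) :
    ∃ t, symMatrix t = M :=
  ⟨Sym2.lift ⟨fun i j => M i j, fun i j => hM.apply j i⟩, rfl⟩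

theorem symMatrix_eq {R : Type*} (t : Sym2 (Fin 3) → R) :
    symMatrix t = !![t s(0, 0), t s(0, 1), t s(0, 2); t s(0, 1), t s(1, 1), t s(1, 2);
      t s(0, 2), t s(1, 2), t s(2, 2)] := by
  have h1 : (s(1, 0) : Sym2 (Fin 3)) = s(0, 1) := Sym2.eq_swap
  have h2 : (s(2, 0) : Sym2 (Fin 3)) = s(0, 2) := Sym2.eq_swap
  have h3 : (s(2, 1) : Sym2 (Fin 3)) = s(1, 2) := Sym2.eq_swap
  ext i j
  fin_cases i <;> fin_cases j <;> simp [symMatrix_apply, h1, h2, h3]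

/-- Jacobi's formula for the derivative of a determinant. -/
theorem nrmDiff_eq_trace {R : Type*} [CommRing R] (t u : Sym2 (Fin 3) → R) :
    nrmDiff t u = ((symMatrix t).adjugate * symMatrix u).trace := by
  rw [symMatrix_eq, symMatrix_eq, Matrix.adjugate_fin_three, Matrix.trace_fin_three]
  simp [Matrix.mul_apply, Fin.sum_univ_three, nrmDiff]
  ring

/-- After division by `N(t)²` this reads `-∂ᵤ∂ᵥ log N = tr(T⁻¹ V T⁻¹ U)`. The polynomial form needs
no invertibility, and it is what makes the Kähler metric a trace form. -/
theorem nrmDiff_mul_sub_nrmHess {R : Type*} [CommRing R] (t u v : Sym2 (Fin 3) → R) :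
    nrmDiff t u * nrmDiff t v - nrm t * nrmHess t u v =
      ((symMatrix t).adjugate * symMatrix v * (symMatrix t).adjugate * symMatrix u).trace := by
  rw [symMatrix_eq, symMatrix_eq, symMatrix_eq, Matrix.adjugate_fin_three, Matrix.trace_fin_three]
  simp [Matrix.mul_apply, Fin.sum_univ_three, nrmDiff, nrmHess, nrm]
  ring

theorem trace_mul_symMatrix {R : Type*} [CommRing R] (A : Matrix (Fin 3) (Fin 3) R)
    (u : Sym2 (Fin 3) → R) :
    ∑ i, (A * symMatrix (Pi.single i 1)).trace * u i = (A * symMatrix u).trace := by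
  simp only [symMatrix_eq, Matrix.trace_fin_three, Matrix.mul_apply, Fin.sum_univ_three,
    sum_sym2_fin_three, Pi.single_apply]
  simp [show (s(0, 0) : Sym2 (Fin 3)) ≠ s(0, 1) by decide,
    show (s(0, 0) : Sym2 (Fin 3)) ≠ s(0, 2) by decide]
  ring

/-- The symmetric matrix representing a linear form on symmetric matrices for the trace pairing. -/
theorem exists_isSymm_trace (c : Sym2 (Fin 3) → ℂ) :
    ∃ A : Matrix (Fin 3) (Fin 3) ℂ, A.IsSymm ∧
      ∀ i, (A * symMatrix (Pi.single i 1)).trace = c i := by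
  -- The halves appear because the basis matrix of an off-diagonal coordinate has two nonzero
  -- entries.
  refine ⟨!![c s(0, 0), c s(0, 1) / 2, c s(0, 2) / 2; c s(0, 1) / 2, c s(1, 1), c s(1, 2) / 2;
      c s(0, 2) / 2, c s(1, 2) / 2, c s(2, 2)], ?_, ?_⟩
  · refine Matrix.IsSymm.ext fun i j => ?_
    fin_cases i <;> fin_cases j <;> rfl
  · intro i
    induction i using sym2_fin_three_cases <;>
    simp [symMatrix_eq, Matrix.trace_fin_three]

theorem isUnit_of_forall_exists_mulVec {ι : Type*} [Fintype ι] [DecidableEq ι] {g : Matrix ι ι ℂ}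
    (h : ∀ c, ∃ w, g *ᵥ w = c) : IsUnit g :=
  Matrix.mulVec_surjective_iff_isUnit.1 h

/-- A metric given by `tr(P E_i P E_j)`, with `P` invertible and symmetric, is nondegenerate, and
its inverse is given by `P⁻¹`. -/
theorem inv_trace_form_mulVec {g : Matrix (Sym2 (Fin 3)) (Sym2 (Fin 3)) ℂ}
    {P R : Matrix (Fin 3) (Fin 3) ℂ} (hPR : P * R = 1) (hR : R.IsSymm)
    (hg : ∀ i j, g i j =
      (P * symMatrix (Pi.single i 1) * P * symMatrix (Pi.single j 1)).trace)
    {A : Matrix (Fin 3) (Fin 3) ℂ} (c w : Sym2 (Fin 3) → ℂ)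
    (hc : ∀ i, c i = (A * symMatrix (Pi.single i 1)).trace) (hw : symMatrix w = R * A * R) :
    g⁻¹ *ᵥ c = w := by
  -- As `R = P⁻¹`, `tr(P Eᵢ P · R A R) = tr(A Eᵢ)`, so `R A R` solves `g w = c`. Applied to every
  -- linear form, this also shows that `g` is surjective, hence invertible.
  have key : ∀ {A : Matrix (Fin 3) (Fin 3) ℂ} {c w : Sym2 (Fin 3) → ℂ},
      (∀ i, c i = (A * symMatrix (Pi.single i 1)).trace) → symMatrix w = R * A * R →
      g *ᵥ w = c := by
    intro A c w hc hw
    funext i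
    have hRP : R * P = 1 := mul_eq_one_comm.1 hPR
    simp only [Matrix.mulVec, dotProduct, hg]
    rw [trace_mul_symMatrix, hw, hc, Matrix.trace_mul_comm A]
    have e : P * symMatrix (Pi.single i 1) * P * (R * A * R) =
        P * (symMatrix (Pi.single i 1) * (P * R) * A * R) := by simp only [Matrix.mul_assoc]
    rw [e, hPR, Matrix.mul_one, Matrix.trace_mul_comm, Matrix.mul_assoc _ R P, hRP, Matrix.mul_one]
  have hu : IsUnit g := by
    refine isUnit_of_forall_exists_mulVec fun c => ?_
    obtain ⟨A, hA, hc⟩ := exists_isSymm_trace c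
    obtain ⟨w, hw⟩ := exists_symMatrix (M := R * A * R) (by
      rw [Matrix.IsSymm, Matrix.transpose_mul, Matrix.transpose_mul, hR, hA, Matrix.mul_assoc])
    exact ⟨w, key (fun i => (hc i).symm) hw⟩
  have hd : IsUnit g.det := (Matrix.isUnit_iff_isUnit_det _).1 hu
  rw [← key hc hw, Matrix.mulVec_mulVec, Matrix.nonsing_inv_mul _ hd, Matrix.one_mulVec]

/-! ## Special geometry in coordinates -/

/-- The imaginary parts of the coordinates. -/
def imPart (t : Sym2 (Fin 3) → ℂ) : Sym2 (Fin 3) → ℝ := fun i => (t i).im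

/-- The real parts of the coordinates. -/
def rePart (t : Sym2 (Fin 3) → ℂ) : Sym2 (Fin 3) → ℝ := fun i => (t i).re

/-- The quotient rule for `N(X^i) / X^0` at `X^0 = 1`. -/
theorem hasFDerivAt_prepotential (t : Sym2 (Fin 3) → ℂ) :
    ∃ L : (Option (Sym2 (Fin 3)) → ℂ) →L[ℂ] ℂ, HasFDerivAt prepotential L (specialCoords t) ∧
      L (Pi.single none 1) = -nrm t ∧
        ∀ i, L (Pi.single (some i) 1) = nrmDiff t (Pi.single i 1) := by
  obtain ⟨L, hL, hLu⟩ := hasFDerivAt_nrm t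
  let r : (Option (Sym2 (Fin 3)) → ℂ) →L[ℂ] (Sym2 (Fin 3) → ℂ) :=
    ContinuousLinearMap.pi fun i => ContinuousLinearMap.proj (some i)
  have h1 : HasFDerivAt (fun x : Option (Sym2 (Fin 3)) → ℂ => nrm fun i => x (some i))
      (L.comp r) (specialCoords t) :=
    HasFDerivAt.comp (f := r) (specialCoords t) hL r.hasFDerivAt
  have h2 := h1.mul ((hasDerivAt_inv (x := specialCoords t none) one_ne_zero).comp_hasFDerivAt
    (specialCoords t) (hasFDerivAt_apply none (specialCoords t)))
  have h3 : (prepotential : (Option (Sym2 (Fin 3)) → ℂ) → ℂ) =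
      fun x => (nrm fun i => x (some i)) * (x none)⁻¹ := by
    funext x; rw [prepotential, det_symMatrix, div_eq_mul_inv]
  rw [h3]
  refine ⟨_, h2, ?_, fun i => ?_⟩
  · have : r (Pi.single none 1) = 0 := by ext i; simp [r]
    simp [this, specialCoords]
  · have : r (Pi.single (some i) 1) = Pi.single i 1 := by
      ext j; simp [r, Pi.single_apply]
    simp [this, specialCoords, hLu]

theorem Omega_fst (t : Sym2 (Fin 3) → ℂ) : (Omega t).1 = specialCoords t := rfl

theorem Omega_snd_none (t : Sym2 (Fin 3) → ℂ) : (Omega t).2 none = -nrm t := by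
  obtain ⟨L, hL, h0, -⟩ := hasFDerivAt_prepotential t
  simp only [Omega, hL.fderiv, h0]

theorem Omega_snd_some (t : Sym2 (Fin 3) → ℂ) (i : Sym2 (Fin 3)) :
    (Omega t).2 (some i) = nrmDiff t (Pi.single i 1) := by
  obtain ⟨L, hL, -, h1⟩ := hasFDerivAt_prepotential t
  simp only [Omega, hL.fderiv, h1]

theorem centralCharge_chargeD0D6 (p0 q0 : ℝ) :
    centralCharge (chargeD0D6 p0 q0) = fun t => -((p0 : ℂ) * nrm t + q0) := by
  funext t
  simp [centralCharge, chargeD0D6, sympl, Fintype.sum_option, Omega_fst, Omega_snd_none,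
    specialCoords]
  ring

theorem conj_nrm (t : Sym2 (Fin 3) → ℂ) :
    starRingEnd ℂ (nrm t) = nrm fun i => starRingEnd ℂ (t i) := by
  simp [nrm, map_ofNat (starRingEnd ℂ)]

theorem conj_nrmDiff (t u : Sym2 (Fin 3) → ℂ) :
    starRingEnd ℂ (nrmDiff t u) = nrmDiff (fun i => starRingEnd ℂ (t i))
      fun i => starRingEnd ℂ (u i) := by
  simp [nrmDiff, map_ofNat (starRingEnd ℂ)]

theorem conj_nrmDiff_single (t : Sym2 (Fin 3) → ℂ) (i : Sym2 (Fin 3)) :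
    starRingEnd ℂ (nrmDiff t (Pi.single i 1)) =
      nrmDiff (fun i => starRingEnd ℂ (t i)) (Pi.single i 1) := by
  rw [conj_nrmDiff]
  congr 1
  ext j
  by_cases h : j = i <;> simp [h]

/-- The symplectic product is the expansion of the cubic form `N(t - t̄) = N(2iY) = -8i N(Y)`. -/
theorem expNegK_eq (t : Sym2 (Fin 3) → ℂ) : expNegK t = 8 * nrm (imPart t) := by
  have h : sympl (Omega t) (conjFTS (Omega t)) =
      -nrm (fun i => starRingEnd ℂ (t i)) + nrm t + nrmDiff (fun i => starRingEnd ℂ (t i)) t -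
        nrmDiff t (fun i => starRingEnd ℂ (t i)) := by
    simp only [sympl, conjFTS, Fintype.sum_option, Omega_fst, Omega_snd_none, Omega_snd_some,
      specialCoords, map_one, map_neg, conj_nrm, conj_nrmDiff_single, one_mul, mul_one]
    rw [Finset.sum_sub_distrib, ← sum_nrmDiff _ t, ← sum_nrmDiff t]
    simp only [mul_comm (t _)]
    ring
  rw [expNegK, h]
  simp [nrm, nrmDiff, imPart, pow_two]
  ring

/-- The imaginary part as a real linear map on coordinates. -/
noncomputable def imCoordsCLM : (Sym2 (Fin 3) → ℂ) →L[ℝ] (Sym2 (Fin 3) → ℝ) :=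
  ContinuousLinearMap.pi fun i => Complex.imCLM.comp (ContinuousLinearMap.proj i)

theorem imCoordsCLM_apply (t : Sym2 (Fin 3) → ℂ) : imCoordsCLM t = imPart t := rfl

theorem imPart_single_one (i : Sym2 (Fin 3)) : imPart (Pi.single i 1) = 0 := by
  ext j
  by_cases h : j = i <;> simp [imPart, h]

theorem imPart_single_I (i : Sym2 (Fin 3)) :
    imPart (Pi.single i Complex.I) = Pi.single i 1 := by
  ext j
  by_cases h : j = i <;> simp [imPart, h]

theorem fderiv_ofReal_comp_imPart {f : (Sym2 (Fin 3) → ℂ) → ℂ} {φ : (Sym2 (Fin 3) → ℝ) → ℝ}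
    {L : (Sym2 (Fin 3) → ℝ) →L[ℝ] ℝ} {t : Sym2 (Fin 3) → ℂ} (c : ℂ)
    (hL : HasFDerivAt φ L (imPart t)) (hf : ∀ᶠ t in nhds t, f t = c * φ (imPart t)) :
    fderiv ℝ f t = c • Complex.ofRealCLM.comp (L.comp imCoordsCLM) := by
  rw [Filter.EventuallyEq.fderiv_eq hf]
  have h1 : HasFDerivAt (fun t => φ (imPart t)) (L.comp imCoordsCLM) t :=
    HasFDerivAt.comp (f := imCoordsCLM) t hL imCoordsCLM.hasFDerivAt
  exact ((Complex.ofRealCLM.hasFDerivAt.comp t h1).const_mul c).fderiv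

/-- On functions of `y = Im t` alone, `∂/∂tⁱ = -(i/2) ∂/∂yᵢ`. Agreement near `t` suffices, which
matters because the first derivatives of `K` are computed only where `N(Y) ≠ 0`. -/
theorem dHol_ofReal_comp_imPart {f : (Sym2 (Fin 3) → ℂ) → ℂ} {φ : (Sym2 (Fin 3) → ℝ) → ℝ}
    {L : (Sym2 (Fin 3) → ℝ) →L[ℝ] ℝ} {t : Sym2 (Fin 3) → ℂ} (c : ℂ)
    (hL : HasFDerivAt φ L (imPart t)) (hf : ∀ᶠ t in nhds t, f t = c * φ (imPart t))
    (i : Sym2 (Fin 3)) : dHol i f t = -(Complex.I / 2) * c * L (Pi.single i 1) := by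
  rw [dHol, fderiv_ofReal_comp_imPart c hL hf]
  simp [imCoordsCLM_apply, imPart_single_one, imPart_single_I]
  ring

theorem dAnti_ofReal_comp_imPart {f : (Sym2 (Fin 3) → ℂ) → ℂ} {φ : (Sym2 (Fin 3) → ℝ) → ℝ}
    {L : (Sym2 (Fin 3) → ℝ) →L[ℝ] ℝ} {t : Sym2 (Fin 3) → ℂ} (c : ℂ)
    (hL : HasFDerivAt φ L (imPart t)) (hf : ∀ᶠ t in nhds t, f t = c * φ (imPart t))
    (i : Sym2 (Fin 3)) : dAnti i f t = Complex.I / 2 * c * L (Pi.single i 1) := by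
  rw [dAnti, fderiv_ofReal_comp_imPart c hL hf]
  simp [imCoordsCLM_apply, imPart_single_one, imPart_single_I]
  ring

theorem dHol_of_hasFDerivAt {f : (Sym2 (Fin 3) → ℂ) → ℂ} {L : (Sym2 (Fin 3) → ℂ) →L[ℂ] ℂ}
    {t : Sym2 (Fin 3) → ℂ} (hL : HasFDerivAt f L t) (i : Sym2 (Fin 3)) :
    dHol i f t = L (Pi.single i 1) := by
  have h : L (Pi.single i Complex.I) = Complex.I * L (Pi.single i 1) := by
    rw [← smul_eq_mul, ← map_smul, ← Pi.single_smul, smul_eq_mul, mul_one]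
  rw [dHol, (hL.restrictScalars ℝ).fderiv]
  simp only [ContinuousLinearMap.coe_restrictScalars', h]
  linear_combination (-1 / 2 * L (Pi.single i 1)) * Complex.I_mul_I

theorem kahler_eq (t : Sym2 (Fin 3) → ℂ) :
    kahler t = (-1 : ℂ) * ((Real.log (8 * nrm (imPart t)) : ℝ) : ℂ) := by
  rw [kahler, expNegK_eq]; push_cast; ring

theorem hasFDerivAt_log_nrm {y : Sym2 (Fin 3) → ℝ} (hy : nrm y ≠ 0) :
    ∃ L : (Sym2 (Fin 3) → ℝ) →L[ℝ] ℝ, HasFDerivAt (fun y => Real.log (8 * nrm y)) L y ∧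
      ∀ u, L u = nrmDiff y u / nrm y := by
  obtain ⟨L, hL, hLu⟩ := hasFDerivAt_nrm y
  refine ⟨_, (hL.const_mul 8).log (mul_ne_zero (by norm_num) hy), fun u => ?_⟩
  simp [hLu]
  field_simp

theorem dHol_kahler {t : Sym2 (Fin 3) → ℂ} (ht : nrm (imPart t) ≠ 0) (i : Sym2 (Fin 3)) :
    dHol i kahler t =
      Complex.I / 2 * ((nrmDiff (imPart t) (Pi.single i 1) / nrm (imPart t) : ℝ) : ℂ) := by
  obtain ⟨L, hL, hLu⟩ := hasFDerivAt_log_nrm ht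
  rw [dHol_ofReal_comp_imPart (-1) hL (Filter.Eventually.of_forall kahler_eq), hLu]
  ring

theorem dAnti_kahler {t : Sym2 (Fin 3) → ℂ} (ht : nrm (imPart t) ≠ 0) (i : Sym2 (Fin 3)) :
    dAnti i kahler t =
      -(Complex.I / 2) * ((nrmDiff (imPart t) (Pi.single i 1) / nrm (imPart t) : ℝ) : ℂ) := by
  obtain ⟨L, hL, hLu⟩ := hasFDerivAt_log_nrm ht
  rw [dAnti_ofReal_comp_imPart (-1) hL (Filter.Eventually.of_forall kahler_eq), hLu]
  ring

theorem hasFDerivAt_nrmDiff (y u : Sym2 (Fin 3) → ℝ) :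
    ∃ L : (Sym2 (Fin 3) → ℝ) →L[ℝ] ℝ, HasFDerivAt (fun y => nrmDiff y u) L y ∧
      ∀ v, L v = nrmHess y u v := by
  have h : ∀ i, HasFDerivAt (fun t : Sym2 (Fin 3) → ℝ => t i)
    (ContinuousLinearMap.proj (R := ℝ) (φ := fun _ : Sym2 (Fin 3) => ℝ) i) y :=
    fun i => hasFDerivAt_apply i y
  refine ⟨_, (((((((h s(1,1)).mul (h s(2,2))).sub ((h s(1,2)).pow 2)).mul_const (u s(0,0))).add
    ((((h s(0,0)).mul (h s(2,2))).sub ((h s(0,2)).pow 2)).mul_const (u s(1,1)))).add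
    ((((h s(0,0)).mul (h s(1,1))).sub ((h s(0,1)).pow 2)).mul_const (u s(2,2)))).add
    (((((h s(0,2)).mul (h s(1,2))).sub ((h s(0,1)).mul (h s(2,2)))).const_mul 2).mul_const
      (u s(0,1)))).add
    (((((h s(0,1)).mul (h s(1,2))).sub ((h s(0,2)).mul (h s(1,1)))).const_mul 2).mul_const
      (u s(0,2))) |>.add
    (((((h s(0,1)).mul (h s(0,2))).sub ((h s(1,2)).mul (h s(0,0)))).const_mul 2).mul_const
      (u s(1,2))), fun v => ?_⟩
  simp [nrmHess, nrmDiff]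
  ring

theorem continuous_nrm_imPart : Continuous fun t : Sym2 (Fin 3) → ℂ => nrm (imPart t) := by
  unfold nrm imPart
  fun_prop

/-- Since `K = -log (8 N(Y))`, the metric is `-1/4` times the Hessian of `log N` in the variables
`y`. -/
theorem metric_apply {t : Sym2 (Fin 3) → ℂ} (ht : nrm (imPart t) ≠ 0) (i j : Sym2 (Fin 3)) :
    metric t i j = ((((nrmDiff (imPart t) (Pi.single j 1) * nrmDiff (imPart t) (Pi.single i 1) -
      nrm (imPart t) * nrmHess (imPart t) (Pi.single j 1) (Pi.single i 1)) /
        (2 * nrm (imPart t)) ^ 2) : ℝ) : ℂ) := by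
  obtain ⟨L, hL, hLu⟩ := hasFDerivAt_nrmDiff (imPart t) (Pi.single j 1)
  obtain ⟨M, hM, hMu⟩ := hasFDerivAt_nrm (imPart t)
  have h1 := hL.mul ((hasDerivAt_inv ht).comp_hasFDerivAt _ hM)
  have hev : ∀ᶠ s in nhds t, dAnti j kahler s = -(Complex.I / 2) *
      (((fun y => nrmDiff y (Pi.single j 1) * (nrm y)⁻¹) (imPart s) : ℝ) : ℂ) := by
    filter_upwards [continuous_nrm_imPart.continuousAt.eventually_ne ht] with s hs
    simp only [dAnti_kahler hs, div_eq_mul_inv]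
  change dHol i (dAnti j kahler) t = _
  rw [dHol_ofReal_comp_imPart _ h1 hev]
  simp [hLu, hMu]
  have h0 : ((nrm (imPart t) : ℝ) : ℂ) ≠ 0 := by exact_mod_cast ht
  have hI : Complex.I ^ 2 = -1 := Complex.I_sq
  field_simp
  rw [hI]
  ring

/-! ## The effective potential of the charge `(p⁰, 0, q₀, 0)` -/

/-- The imaginary parts of the coordinates, as complex numbers. -/
def imC (t : Sym2 (Fin 3) → ℂ) : Sym2 (Fin 3) → ℂ := fun i => ((imPart t i : ℝ) : ℂ)

theorem nrm_imC (t : Sym2 (Fin 3) → ℂ) : nrm (imC t) = ((nrm (imPart t) : ℝ) : ℂ) := by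
  simp [nrm, imC]

theorem nrmDiff_imC (t : Sym2 (Fin 3) → ℂ) (i : Sym2 (Fin 3)) :
    nrmDiff (imC t) (Pi.single i 1) = ((nrmDiff (imPart t) (Pi.single i 1) : ℝ) : ℂ) := by
  have h : ∀ k, ((Pi.single i (1 : ℝ) : Sym2 (Fin 3) → ℝ) k : ℂ) =
      (Pi.single i 1 : Sym2 (Fin 3) → ℂ) k :=
    fun k => by by_cases hk : k = i <;> simp [hk]
  simp [nrmDiff, imC, h]

theorem nrmHess_imC (t : Sym2 (Fin 3) → ℂ) (i j : Sym2 (Fin 3)) :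
    nrmHess (imC t) (Pi.single i 1) (Pi.single j 1) =
      ((nrmHess (imPart t) (Pi.single i 1) (Pi.single j 1) : ℝ) : ℂ) := by
  have h : ∀ l k, ((Pi.single l (1 : ℝ) : Sym2 (Fin 3) → ℝ) k : ℂ) =
      (Pi.single l 1 : Sym2 (Fin 3) → ℂ) k :=
    fun l k => by by_cases hk : k = l <;> simp [hk]
  simp [nrmHess, nrmDiff, imC, h]

theorem symMatrix_imC (t : Sym2 (Fin 3) → ℂ) :
    (2 * Complex.I) • symMatrix (imC t) =
      symMatrix t - symMatrix fun i => starRingEnd ℂ (t i) := by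
  ext i j
  simp only [Matrix.smul_apply, Matrix.sub_apply, symMatrix_apply, imC, imPart, smul_eq_mul]
  apply Complex.ext <;> simp
  ring

/-- The matrix representing the covariant derivative of the central charge for the trace
pairing. -/
noncomputable def covMatrix (p0 q0 : ℝ) (t : Sym2 (Fin 3) → ℂ) : Matrix (Fin 3) (Fin 3) ℂ :=
  -(p0 : ℂ) • (symMatrix t).adjugate -
    (Complex.I / 2 * (p0 * nrm t + q0) / nrm (imC t)) • (symMatrix (imC t)).adjugate

theorem covDeriv_eq (p0 q0 : ℝ) {t : Sym2 (Fin 3) → ℂ} (ht : nrm (imPart t) ≠ 0)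
    (i : Sym2 (Fin 3)) : covDeriv (chargeD0D6 p0 q0) i t =
      (covMatrix p0 q0 t * symMatrix (Pi.single i 1)).trace := by
  obtain ⟨L, hL, hLu⟩ := hasFDerivAt_nrm t
  have h1 : HasFDerivAt (fun t => -((p0 : ℂ) * nrm t + q0)) (-((p0 : ℂ) • L)) t :=
    ((hL.const_mul (p0 : ℂ)).add_const (q0 : ℂ)).neg
  rw [covDeriv, centralCharge_chargeD0D6, dHol_kahler ht, dHol_of_hasFDerivAt h1, covMatrix,
    Matrix.sub_mul, Matrix.smul_mul, Matrix.smul_mul, Matrix.trace_sub, Matrix.trace_smul,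
    Matrix.trace_smul, ← nrmDiff_eq_trace, ← nrmDiff_eq_trace, nrmDiff_imC, nrm_imC]
  simp [hLu]
  ring

/-- Substitute `Y = (T - T̄) / 2i`: as `adj(T) T = N(t)`, the terms in `N(t)` cancel. -/
theorem covMatrix_mul (p0 q0 : ℝ) {t : Sym2 (Fin 3) → ℂ} (ht : nrm (imPart t) ≠ 0) :
    covMatrix p0 q0 t * symMatrix (imC t) = (-(Complex.I / 2)) •
      ((p0 : ℂ) • ((symMatrix t).adjugate * symMatrix fun i => starRingEnd ℂ (t i)) +
        (q0 : ℂ) • 1) := by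
  have h0 : nrm (imC t) ≠ 0 := by rw [nrm_imC]; exact_mod_cast ht
  have h1 : symMatrix (imC t) = (-(Complex.I / 2)) •
      (symMatrix t - symMatrix fun i => starRingEnd ℂ (t i)) := by
    rw [← symMatrix_imC, smul_smul]
    rw [show -(Complex.I / 2) * (2 * Complex.I) = 1 by linear_combination -Complex.I_mul_I,
      one_smul]
  rw [covMatrix, Matrix.sub_mul, Matrix.smul_mul, Matrix.smul_mul, Matrix.adjugate_mul,
    det_symMatrix, smul_smul, div_mul_cancel₀ _ h0, h1, Matrix.mul_smul, Matrix.mul_sub,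
    Matrix.adjugate_mul, det_symMatrix]
  module

theorem map_conj_symMatrix (t : Sym2 (Fin 3) → ℂ) :
    (symMatrix t).map (starRingEnd ℂ) = symMatrix fun i => starRingEnd ℂ (t i) := rfl

theorem map_conj_smul (c : ℂ) (M : Matrix (Fin 3) (Fin 3) ℂ) :
    (c • M).map (starRingEnd ℂ) = starRingEnd ℂ c • M.map (starRingEnd ℂ) := by
  ext i j; simp

theorem conj_covMatrix_mul (p0 q0 : ℝ) {t : Sym2 (Fin 3) → ℂ} (ht : nrm (imPart t) ≠ 0) :
    (covMatrix p0 q0 t).map (starRingEnd ℂ) * symMatrix (imC t) = (Complex.I / 2) •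
      ((p0 : ℂ) • ((symMatrix fun i => starRingEnd ℂ (t i)).adjugate * symMatrix t) +
        (q0 : ℂ) • 1) := by
  have h := congrArg (fun M => M.map (starRingEnd ℂ)) (covMatrix_mul p0 q0 ht)
  have e1 : (symMatrix (imC t)).map (starRingEnd ℂ) = symMatrix (imC t) := by
    ext i j; simp [symMatrix_apply, imC]
  have e2 : (symMatrix fun i => starRingEnd ℂ (t i)).map (starRingEnd ℂ) = symMatrix t := by
    ext i j; simp [symMatrix_apply]
  simp only [Matrix.map_mul, e1] at h
  rw [h, map_conj_smul, Matrix.map_add _ (fun a b => map_add _ a b), map_conj_smul,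
    map_conj_smul, Matrix.map_mul, e2,
    Matrix.map_one _ (map_zero _) (map_one _), ← map_conj_symMatrix]
  have e3 : (symMatrix t).adjugate.map (starRingEnd ℂ) =
      ((symMatrix t).map (starRingEnd ℂ)).adjugate := by
    simpa using (RingHom.map_adjugate (starRingEnd ℂ) (symMatrix t))
  have e4 : starRingEnd ℂ (-(Complex.I / 2)) = Complex.I / 2 := by
    simp [map_ofNat (starRingEnd ℂ), neg_div]
  rw [e3, e4, Complex.conj_ofReal, Complex.conj_ofReal]

/-- With `A` representing `D𝒵`, the inverse metric turns the sum into `4 tr(Ā Y A Y)`, and both `A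
Y` and `Ā Y` have the simple form found above. -/
theorem sum_inv_metric (p0 q0 : ℝ) {t : Sym2 (Fin 3) → ℂ} (ht : nrm (imPart t) ≠ 0) :
    ∑ i, ∑ j, (metric t)⁻¹ j i * covDeriv (chargeD0D6 p0 q0) i t *
      starRingEnd ℂ (covDeriv (chargeD0D6 p0 q0) j t) =
    3 * (p0 * nrm t) * (p0 * starRingEnd ℂ (nrm t)) + 3 * q0 ^ 2 + p0 * q0 *
      (nrmDiff t (fun i => starRingEnd ℂ (t i)) + nrmDiff (fun i => starRingEnd ℂ (t i)) t) := by
  have h0 : nrm (imC t) ≠ 0 := by rw [nrm_imC]; exact_mod_cast ht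
  set Y := symMatrix (imC t) with hY
  set A := covMatrix p0 q0 t with hA
  have hYs : Y.IsSymm := symMatrix_isSymm _
  have hAs : A.IsSymm := by
    have h1 : (symMatrix t).adjugate.IsSymm := by
      rw [Matrix.IsSymm, Matrix.adjugate_transpose, symMatrix_isSymm]
    have h2 : Y.adjugate.IsSymm := by
      rw [Matrix.IsSymm, Matrix.adjugate_transpose, hYs]
    exact (h1.smul _).sub (h2.smul _)
  obtain ⟨w, hw⟩ := exists_symMatrix (M := (2 : ℂ) • Y * A * (2 : ℂ) • Y) (by
    rw [Matrix.IsSymm, Matrix.transpose_mul, Matrix.transpose_mul, Matrix.transpose_smul, hYs,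
      hAs, Matrix.mul_assoc])
  have hinv : (metric t)⁻¹ *ᵥ (fun i => covDeriv (chargeD0D6 p0 q0) i t) = w := by
    -- Here `P = (2 N(Y))⁻¹ adj Y` is `(2Y)⁻¹`, the matrix of the trace form of the metric.
    refine inv_trace_form_mulVec (P := (2 * nrm (imC t))⁻¹ • Y.adjugate) (R := (2 : ℂ) • Y) (A := A)
      ?_ (hYs.smul _) (fun i j => ?_) _ w (fun i => covDeriv_eq p0 q0 ht i) hw
    · rw [Matrix.smul_mul, Matrix.mul_smul, Matrix.adjugate_mul, hY, det_symMatrix, smul_smul,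
        smul_smul, mul_assoc, inv_mul_cancel₀ (mul_ne_zero two_ne_zero h0), one_smul]
    · rw [metric_apply ht]
      push_cast
      rw [← nrmDiff_imC, ← nrmDiff_imC, ← nrmHess_imC, ← nrm_imC, nrmDiff_mul_sub_nrmHess]
      simp only [Matrix.smul_mul, Matrix.mul_smul, Matrix.trace_smul, smul_eq_mul]
      ring
  have e1 : ∀ j, starRingEnd ℂ (covDeriv (chargeD0D6 p0 q0) j t) =
      (A.map (starRingEnd ℂ) * symMatrix (Pi.single j 1)).trace := by
    intro j
    have e : (symMatrix (Pi.single j (1 : ℂ))) =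
        (symMatrix (Pi.single j (1 : ℂ))).map (starRingEnd ℂ) := by
      ext a b
      by_cases h : s(a, b) = j <;> simp [symMatrix_apply, h]
    rw [covDeriv_eq p0 q0 ht, e, ← Matrix.map_mul, ← e]
    rw [Matrix.trace, map_sum]
    rfl
  calc _ = ∑ j, starRingEnd ℂ (covDeriv (chargeD0D6 p0 q0) j t) *
        ((metric t)⁻¹ *ᵥ (fun i => covDeriv (chargeD0D6 p0 q0) i t)) j := by
        rw [Finset.sum_comm]
        simp only [Matrix.mulVec, dotProduct, Finset.mul_sum]
        refine Finset.sum_congr rfl fun _ _ => Finset.sum_congr rfl fun _ _ => by ring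
    _ = 4 * (A.map (starRingEnd ℂ) * Y * (A * Y)).trace := by
        rw [hinv]
        simp only [e1]
        rw [trace_mul_symMatrix, hw]
        simp only [Matrix.smul_mul, Matrix.mul_smul, Matrix.trace_smul, smul_eq_mul,
          Matrix.mul_assoc]
        ring
    _ = _ := by
        rw [covMatrix_mul p0 q0 ht, conj_covMatrix_mul p0 q0 ht, Matrix.smul_mul, Matrix.mul_smul]
        simp only [add_mul, mul_add, Matrix.smul_mul, Matrix.mul_smul, Matrix.one_mul,
          Matrix.mul_one, Matrix.trace_smul, Matrix.trace_add, smul_eq_mul, Matrix.trace_one]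
        rw [← nrmDiff_eq_trace, ← nrmDiff_eq_trace]
        -- The inner factor `T adj(T)` is the scalar `N(t)`, which leaves `adj(T̄) T̄ = N(t̄)` and
        -- the trace of the identity.
        have e2 : ((symMatrix fun i => starRingEnd ℂ (t i)).adjugate * symMatrix t *
            ((symMatrix t).adjugate * symMatrix fun i => starRingEnd ℂ (t i))).trace =
            3 * (nrm t * starRingEnd ℂ (nrm t)) := by
          rw [Matrix.mul_assoc, ← Matrix.mul_assoc (symMatrix t), Matrix.mul_adjugate,
            det_symMatrix, Matrix.smul_mul, Matrix.one_mul, Matrix.mul_smul, Matrix.adjugate_mul,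
            det_symMatrix, conj_nrm]
          simp
          ring
        rw [e2]
        simp
        linear_combination (-(3 * (p0 * nrm t) * (p0 * starRingEnd ℂ (nrm t)) + 3 * q0 ^ 2 +
          p0 * q0 * (nrmDiff t (fun i => starRingEnd ℂ (t i)) +
            nrmDiff (fun i => starRingEnd ℂ (t i)) t))) * Complex.I_mul_I

/-- The real part of the expansion of `N(t + t̄) = N(2X)`, in which `N(t)` and `N(t̄)` have equal
real parts. -/
theorem re_nrmDiff_conj (t : Sym2 (Fin 3) → ℂ) :
    (2 * nrm t + nrmDiff t (fun i => starRingEnd ℂ (t i)) +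
      nrmDiff (fun i => starRingEnd ℂ (t i)) t).re = 8 * nrm (rePart t) := by
  simp [nrm, nrmDiff, rePart, pow_two]
  ring

/-- The contributions of `Re N(t)` from `|𝒵|²` and from `|D𝒵|²` cancel, so the mixed term involves
`N(X)` only. -/
theorem effPotential_chargeD0D6 (p0 q0 : ℝ) {t : Sym2 (Fin 3) → ℂ} (ht : nrm (imPart t) ≠ 0) :
    effPotential (chargeD0D6 p0 q0) t =
      (q0 ^ 2 + 2 * p0 * q0 * nrm (rePart t) + p0 ^ 2 * Complex.normSq (nrm t)) /
        (2 * nrm (imPart t)) := by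
  rw [effPotential, sum_inv_metric p0 q0 ht, expNegK_eq, centralCharge_chargeD0D6, norm_neg,
    ← Complex.normSq_eq_norm_sq]
  have e1 : (3 * (p0 * nrm t) * (p0 * starRingEnd ℂ (nrm t)) + 3 * (q0 : ℂ) ^ 2 + p0 * q0 *
      (nrmDiff t (fun i => starRingEnd ℂ (t i)) +
        nrmDiff (fun i => starRingEnd ℂ (t i)) t)).re =
      3 * p0 ^ 2 * Complex.normSq (nrm t) + 3 * q0 ^ 2 + p0 * q0 *
        (8 * nrm (rePart t) - 2 * (nrm t).re) := by
    rw [← re_nrmDiff_conj]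
    simp [Complex.normSq_apply, pow_two]
    ring
  have e2 : Complex.normSq (p0 * nrm t + q0) =
      p0 ^ 2 * Complex.normSq (nrm t) + 2 * p0 * q0 * (nrm t).re + q0 ^ 2 := by
    simp [Complex.normSq_apply]
    ring
  rw [e1, e2]
  field_simp
  ring

/-! ## Positive definite real symmetric matrices of size three -/

section

open scoped MatrixOrder Matrix.Norms.L2Operator

theorem exists_eq_transpose_mul_self {n : Type*} [Fintype n] [DecidableEq n] {Y : Matrix n n ℝ}
    (hY : Y.PosDef) : ∃ b : Matrix n n ℝ, IsUnit b ∧ Y = bᵀ * b := by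
  obtain ⟨b, hb, h⟩ := CStarAlgebra.isStrictlyPositive_iff_eq_star_mul_self.1
    hY.isStrictlyPositive
  exact ⟨b, hb, by simpa [Matrix.star_eq_conjTranspose] using h⟩

end

/-- Simultaneous diagonalization of a positive definite and a symmetric matrix. -/
theorem exists_simultaneous_diagonalization {n : Type*} [Fintype n] [DecidableEq n]
    {X Y : Matrix n n ℝ} (hX : X.IsSymm) (hY : Y.PosDef) :
    ∃ (S : Matrix n n ℝ) (d : n → ℝ), S.det ≠ 0 ∧ Y = S * Sᵀ ∧
      X = S * Matrix.diagonal d * Sᵀ := by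
  obtain ⟨b, hb, rfl⟩ := exists_eq_transpose_mul_self hY
  have hbd : IsUnit b.det := (Matrix.isUnit_iff_isUnit_det b).1 hb
  have hbd' : IsUnit bᵀ.det := by rwa [Matrix.det_transpose]
  -- An orthogonal `U` diagonalizing this matrix leaves `Y = bᵀ b` unchanged, so `S = bᵀ U` serves
  -- both matrices.
  have hM : (bᵀ⁻¹ * X * b⁻¹).IsHermitian := by
    rw [Matrix.IsHermitian, Matrix.conjTranspose_eq_transpose_of_trivial, Matrix.transpose_mul,
      Matrix.transpose_mul, hX, Matrix.transpose_nonsing_inv, Matrix.transpose_nonsing_inv,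
      Matrix.transpose_transpose, Matrix.mul_assoc]
  have hs := hM.spectral_theorem
  set U := hM.eigenvectorUnitary
  have hU : (U : Matrix n n ℝ) * (U : Matrix n n ℝ)ᵀ = 1 := by
    have := Unitary.mul_star_self_of_mem U.2
    rwa [Matrix.star_eq_conjTranspose, Matrix.conjTranspose_eq_transpose_of_trivial] at this
  rw [Unitary.conjStarAlgAut_apply, Matrix.star_eq_conjTranspose,
    Matrix.conjTranspose_eq_transpose_of_trivial] at hs
  refine ⟨bᵀ * (U : Matrix n n ℝ), RCLike.ofReal ∘ hM.eigenvalues, ?_, ?_, ?_⟩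
  · rw [Matrix.det_mul]
    refine mul_ne_zero hbd'.ne_zero fun h0 => ?_
    have := congrArg Matrix.det hU
    rw [Matrix.det_mul, h0] at this
    simp at this
  · rw [Matrix.transpose_mul, Matrix.transpose_transpose, Matrix.mul_assoc,
      ← Matrix.mul_assoc (U : Matrix n n ℝ), hU, Matrix.one_mul]
  · rw [Matrix.transpose_mul, Matrix.transpose_transpose]
    calc X = bᵀ * (bᵀ⁻¹ * X * b⁻¹) * b := by
          rw [← Matrix.mul_assoc, ← Matrix.mul_assoc, Matrix.mul_nonsing_inv _ hbd',
            Matrix.one_mul, Matrix.nonsing_inv_mul_cancel_right _ _ hbd]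
      _ = _ := (congrArg (fun M => bᵀ * M * b) hs).trans (by simp only [Matrix.mul_assoc])

/-- Sylvester's criterion, by completing squares. The three polynomial inequalities make the cone
visibly open and translate directly into the domain of the chart used below. -/
theorem posDef_symMatrix_iff (y : Sym2 (Fin 3) → ℝ) :
    (symMatrix y).PosDef ↔ 0 < y s(0, 0) ∧ 0 < y s(0, 0) * y s(1, 1) - y s(0, 1) ^ 2 ∧
      0 < nrm y := by
  have hq : ∀ x : Fin 3 → ℝ, star x ⬝ᵥ (symMatrix y *ᵥ x) =
      y s(0, 0) * x 0 ^ 2 + y s(1, 1) * x 1 ^ 2 + y s(2, 2) * x 2 ^ 2 +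
        2 * y s(0, 1) * x 0 * x 1 + 2 * y s(0, 2) * x 0 * x 2 + 2 * y s(1, 2) * x 1 * x 2 := by
    intro x
    simp [symMatrix_eq, dotProduct, Matrix.mulVec, Fin.sum_univ_three]
    ring
  constructor
  · intro h
    have hpos : ∀ x : Fin 3 → ℝ, x ≠ 0 → 0 < y s(0, 0) * x 0 ^ 2 + y s(1, 1) * x 1 ^ 2 +
        y s(2, 2) * x 2 ^ 2 + 2 * y s(0, 1) * x 0 * x 1 + 2 * y s(0, 2) * x 0 * x 2 +
          2 * y s(1, 2) * x 1 * x 2 := fun x hx => by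
      rw [← hq]; exact h.dotProduct_mulVec_pos hx
    have h0 : 0 < y s(0, 0) := by
      have := hpos ![1, 0, 0] (fun h => by simpa using congrFun h 0)
      simpa using this
    -- The form takes the value `y₀₀ (y₀₀ y₁₁ - y₀₁²)` at this vector.
    have h1 := hpos ![-y s(0, 1), y s(0, 0), 0] (fun h => by simpa [h0.ne'] using congrFun h 1)
    simp at h1
    refine ⟨h0, ?_, by rw [← det_symMatrix]; exact h.det_pos⟩
    have : 0 < y s(0, 0) * (y s(0, 0) * y s(1, 1) - y s(0, 1) ^ 2) := by linarith
    exact pos_of_mul_pos_right this h0.le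
  · rintro ⟨h0, h1, h2⟩
    refine Matrix.PosDef.of_dotProduct_mulVec_pos ?_ fun x hx => ?_
    · rw [Matrix.IsHermitian, Matrix.conjTranspose_eq_transpose_of_trivial]
      exact symMatrix_isSymm y
    · rw [hq]
      set a := y s(0, 0) with ha
      set m := a * y s(1, 1) - y s(0, 1) ^ 2 with hm
      set b := a * x 0 + y s(0, 1) * x 1 + y s(0, 2) * x 2 with hb
      set e := m * x 1 + (a * y s(1, 2) - y s(0, 1) * y s(0, 2)) * x 2 with he
      have key : a * m * (a * x 0 ^ 2 + y s(1, 1) * x 1 ^ 2 + y s(2, 2) * x 2 ^ 2 +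
          2 * y s(0, 1) * x 0 * x 1 + 2 * y s(0, 2) * x 0 * x 2 + 2 * y s(1, 2) * x 1 * x 2) =
          m * b ^ 2 + e ^ 2 + a * nrm y * x 2 ^ 2 := by
        simp only [hb, he, hm, nrm, ← ha]; ring
      refine pos_of_mul_pos_right (a := a * m) ?_ (by positivity)
      rw [key]
      by_contra hle
      have k1 : 0 ≤ m * b ^ 2 := by positivity
      have k2 : 0 ≤ e ^ 2 := by positivity
      have k3 : 0 ≤ a * nrm y * x 2 ^ 2 := by positivity
      have z2 : x 2 = 0 := by
        have : a * nrm y * x 2 ^ 2 = 0 := by linarith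
        simpa [h0.ne', h2.ne'] using this
      have z1 : x 1 = 0 := by
        have : e ^ 2 = 0 := by linarith
        simpa [he, z2, h1.ne'] using this
      have z0 : x 0 = 0 := by
        have : m * b ^ 2 = 0 := by linarith
        simpa [hb, z2, z1, h1.ne', h0.ne'] using this
      exact hx (by ext i; fin_cases i <;> assumption)

theorem isOpen_setOf_posDef_symMatrix :
    IsOpen {y : Sym2 (Fin 3) → ℝ | (symMatrix y).PosDef} := by
  simp only [posDef_symMatrix_iff]
  have h1 : Continuous fun y : Sym2 (Fin 3) → ℝ => y s(0, 0) := by fun_prop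
  have h2 : Continuous fun y : Sym2 (Fin 3) → ℝ => y s(0, 0) * y s(1, 1) - y s(0, 1) ^ 2 := by
    fun_prop
  have h3 : Continuous fun y : Sym2 (Fin 3) → ℝ => nrm y := by unfold nrm; fun_prop
  exact (isOpen_lt continuous_const h1).inter
    ((isOpen_lt continuous_const h2).inter (isOpen_lt continuous_const h3))

/-! ## Critical points of the effective potential -/

theorem symMatrix_rePart_coords (Z : Siegel 3) :
    symMatrix (rePart (coords Z)) = Z.1.map Complex.re := rfl

theorem symMatrix_imPart_coords (Z : Siegel 3) :
    symMatrix (imPart (coords Z)) = Z.1.map Complex.im := rfl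

theorem symMatrix_eq_re_add_im (t : Sym2 (Fin 3) → ℂ) :
    symMatrix t = (symMatrix (rePart t)).map Complex.ofRealHom +
      Complex.I • (symMatrix (imPart t)).map Complex.ofRealHom := by
  ext i j
  simp only [Matrix.add_apply, Matrix.smul_apply, Matrix.map_apply, symMatrix_apply, smul_eq_mul]
  apply Complex.ext <;> simp [rePart, imPart]

theorem nrm_of_diagonalization {t : Sym2 (Fin 3) → ℂ} {S : Matrix (Fin 3) (Fin 3) ℝ}
    {d : Fin 3 → ℝ} (him : symMatrix (imPart t) = S * Sᵀ)
    (hre : symMatrix (rePart t) = S * Matrix.diagonal d * Sᵀ) :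
    nrm t = (S.det : ℂ) ^ 2 * ((d 0 + Complex.I) * (d 1 + Complex.I) * (d 2 + Complex.I)) := by
  have e : symMatrix t = S.map Complex.ofRealHom *
      Matrix.diagonal (fun i => (d i : ℂ) + Complex.I) * (S.map Complex.ofRealHom)ᵀ := by
    rw [symMatrix_eq_re_add_im, him, hre, Matrix.map_mul, Matrix.map_mul, Matrix.map_mul,
      ← Matrix.diagonal_add, Matrix.mul_add, Matrix.add_mul, Matrix.transpose_map,
      Matrix.diagonal_map (map_zero _)]
    congr 1
    rw [show (Matrix.diagonal fun _ : Fin 3 => Complex.I) = Complex.I • 1 by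
      rw [Matrix.smul_one_eq_diagonal], Matrix.mul_smul, Matrix.mul_one, Matrix.smul_mul]
  rw [← det_symMatrix, e, Matrix.det_mul, Matrix.det_mul, Matrix.det_transpose,
    Matrix.det_diagonal, Fin.prod_univ_three, ← RingHom.mapMatrix_apply, ← RingHom.map_det]
  simp only [Complex.ofRealHom_eq_coe]
  ring

theorem normSq_add_I (a : ℝ) : Complex.normSq (a + Complex.I) = a ^ 2 + 1 := by
  simp [Complex.normSq_apply, pow_two]

theorem effPotential_of_diagonalization (p0 q0 : ℝ) {t : Sym2 (Fin 3) → ℂ}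
    {S : Matrix (Fin 3) (Fin 3) ℝ} (hS : S.det ≠ 0) {d : Fin 3 → ℝ}
    (him : symMatrix (imPart t) = S * Sᵀ)
    (hre : symMatrix (rePart t) = S * Matrix.diagonal d * Sᵀ) :
    effPotential (chargeD0D6 p0 q0) t =
      (q0 ^ 2 + 2 * p0 * q0 * (S.det ^ 2 * (d 0 * d 1 * d 2)) + p0 ^ 2 * (S.det ^ 4 *
        ((d 0 ^ 2 + 1) * (d 1 ^ 2 + 1) * (d 2 ^ 2 + 1)))) / (2 * S.det ^ 2) ∧
      nrm (imPart t) = S.det ^ 2 := by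
  have h1 : nrm (imPart t) = S.det ^ 2 := by
    rw [← det_symMatrix, him, Matrix.det_mul, Matrix.det_transpose, pow_two]
  have h2 : nrm (rePart t) = S.det ^ 2 * (d 0 * d 1 * d 2) := by
    rw [← det_symMatrix, hre, Matrix.det_mul, Matrix.det_mul, Matrix.det_transpose,
      Matrix.det_diagonal, Fin.prod_univ_three]
    ring
  refine ⟨?_, h1⟩
  rw [effPotential_chargeD0D6 p0 q0 (by rw [h1]; positivity), h1, h2,
    nrm_of_diagonalization him hre]
  simp only [map_mul, map_pow, normSq_add_I, Complex.normSq_ofReal]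
  ring

theorem HasFDerivAt.hasDerivAt_add_smul {E : Type*} [NormedAddCommGroup E] [NormedSpace ℝ E]
    {f : E → ℝ} {L : E →L[ℝ] ℝ} {x : E} (h : HasFDerivAt f L x) (u : E) :
    HasDerivAt (fun s : ℝ => f (x + s • u)) (L u) 0 := by
  have h1 : HasDerivAt (fun s : ℝ => x + s • u) u 0 := by
    simpa using ((hasDerivAt_id (0 : ℝ)).smul_const u).const_add x
  have h2 : HasFDerivAt f L (x + (0 : ℝ) • u) := by simpa using h
  exact h2.comp_hasDerivAt (0 : ℝ) h1

/-- Multiplying each equation by its own variable and subtracting gives `a² = b² = c²`. Squaring the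
first equation and eliminating `q²` by the last then leaves `(pD)² (a² + 1)³ a² = 0`. -/
theorem eq_zero_of_attractor_equations {p D q a b c : ℝ} (hp : p ≠ 0) (hD : D ≠ 0)
    (ha : q * (b * c) + p * D * (a * ((b ^ 2 + 1) * (c ^ 2 + 1))) = 0)
    (hb : q * (a * c) + p * D * (b * ((a ^ 2 + 1) * (c ^ 2 + 1))) = 0)
    (hc : q * (a * b) + p * D * (c * ((a ^ 2 + 1) * (b ^ 2 + 1))) = 0)
    (hs : q ^ 2 = p ^ 2 * D ^ 2 * ((a ^ 2 + 1) * (b ^ 2 + 1) * (c ^ 2 + 1))) :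
    a = 0 ∧ b = 0 ∧ c = 0 := by
  have hpD : p * D ≠ 0 := mul_ne_zero hp hD
  have hab : b ^ 2 = a ^ 2 := by
    have : p * D * (c ^ 2 + 1) * (b ^ 2 - a ^ 2) = 0 := by linear_combination b * hb - a * ha
    have hc1 : c ^ 2 + 1 ≠ 0 := by positivity
    have := (mul_eq_zero.1 this).resolve_left (mul_ne_zero hpD hc1)
    linarith
  have hac : c ^ 2 = a ^ 2 := by
    have : p * D * (b ^ 2 + 1) * (c ^ 2 - a ^ 2) = 0 := by linear_combination c * hc - a * ha
    have hc1 : b ^ 2 + 1 ≠ 0 := by positivity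
    have := (mul_eq_zero.1 this).resolve_left (mul_ne_zero hpD hc1)
    linarith
  rw [hab, hac] at hs
  have h1 : q ^ 2 * (a ^ 2) ^ 2 = (p * D) ^ 2 * a ^ 2 * (a ^ 2 + 1) ^ 4 := by
    have e : q * (b * c) = -(p * D * (a * ((b ^ 2 + 1) * (c ^ 2 + 1)))) := by linarith
    have := congrArg (fun x => x ^ 2) e
    simp only [mul_pow, neg_sq, hab, hac] at this
    linear_combination this
  have h2 : (p * D) ^ 2 * (a ^ 2 + 1) ^ 3 * a ^ 2 = 0 := by
    rw [hs] at h1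
    linear_combination -h1
  have h3 : a ^ 2 = 0 := by
    have h4 : (p * D) ^ 2 * (a ^ 2 + 1) ^ 3 ≠ 0 := by positivity
    exact (mul_eq_zero.1 h2).resolve_left h4
  rw [h3] at hab hac
  exact ⟨pow_eq_zero_iff two_ne_zero |>.1 h3, pow_eq_zero_iff two_ne_zero |>.1 hab,
    pow_eq_zero_iff two_ne_zero |>.1 hac⟩

/-- A direction that leaves `Y` and `S` alone and moves the single eigenvalue `d_k`. -/
theorem exists_rank_one_direction (S : Matrix (Fin 3) (Fin 3) ℝ) (k : Fin 3) :
    ∃ u : Sym2 (Fin 3) → ℂ, imPart u = 0 ∧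
      symMatrix (rePart u) = S * Matrix.diagonal (Pi.single k 1) * Sᵀ := by
  obtain ⟨r, hr⟩ := exists_symMatrix (M := S * Matrix.diagonal (Pi.single k 1) * Sᵀ) (by
    rw [Matrix.IsSymm, Matrix.transpose_mul, Matrix.transpose_mul, Matrix.transpose_transpose,
      Matrix.diagonal_transpose, Matrix.mul_assoc])
  exact ⟨fun i => (r i : ℂ), by ext i; simp [imPart], by rw [← hr]; congr 1⟩

theorem nrm_smul {R : Type*} [CommRing R] (c : R) (t : Sym2 (Fin 3) → R) :
    nrm (fun i => c * t i) = c ^ 3 * nrm t := by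
  simp only [nrm]; ring

theorem symMatrix_add_smul (r u : Sym2 (Fin 3) → ℝ) (h : ℝ) :
    symMatrix (r + h • u) = symMatrix r + h • symMatrix u := rfl

/-- The effective potential at `S (diag(d) + i) Sᵀ`, where `e = det S`. -/
noncomputable def diagPotential (p0 q0 e : ℝ) (d : Fin 3 → ℝ) : ℝ :=
  (q0 ^ 2 + 2 * p0 * q0 * (e ^ 2 * (d 0 * d 1 * d 2)) + p0 ^ 2 * (e ^ 4 *
    ((d 0 ^ 2 + 1) * (d 1 ^ 2 + 1) * (d 2 ^ 2 + 1)))) / (2 * e ^ 2)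

theorem hasDerivAt_diagPotential (p0 q0 : ℝ) {t : Sym2 (Fin 3) → ℂ}
    (ht : HasFDerivAt (effPotential (chargeD0D6 p0 q0)) (0 : (Sym2 (Fin 3) → ℂ) →L[ℝ] ℝ) t)
    {S : Matrix (Fin 3) (Fin 3) ℝ} (hS : S.det ≠ 0) {d : Fin 3 → ℝ}
    (him : symMatrix (imPart t) = S * Sᵀ)
    (hre : symMatrix (rePart t) = S * Matrix.diagonal d * Sᵀ) (k : Fin 3) :
    HasDerivAt (fun h : ℝ => diagPotential p0 q0 S.det (d + h • (Pi.single k 1 : Fin 3 → ℝ)))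
      0 0 := by
  obtain ⟨u, hu1, hu2⟩ := exists_rank_one_direction S k
  have h1 := ht.hasDerivAt_add_smul u
  refine h1.congr_of_eventuallyEq (Filter.Eventually.of_forall fun h => ?_)
  have e1 : imPart (t + h • u) = imPart t := by
    ext i
    have := congrFun hu1 i
    simp only [imPart, Pi.zero_apply] at this
    simp [imPart, this]
  have e2 : rePart (t + h • u) = rePart t + h • rePart u := by
    ext i; simp [rePart]
  refine (effPotential_of_diagonalization p0 q0 (t := t + h • u) hS
    (d := d + h • (Pi.single k 1 : Fin 3 → ℝ))
    (by rw [e1, him]) ?_).1.symm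
  rw [e2, symMatrix_add_smul, hre, hu2]
  have : (Matrix.diagonal (d + h • (Pi.single k 1 : Fin 3 → ℝ)) : Matrix (Fin 3) (Fin 3) ℝ) =
      Matrix.diagonal d + h • Matrix.diagonal (Pi.single k 1) := by
    rw [← Matrix.diagonal_smul, Matrix.diagonal_add]; rfl
  rw [this, Matrix.mul_add, Matrix.add_mul, Matrix.mul_smul, Matrix.smul_mul]

/-- Along `s t` the potential is `(q₀² s⁻³ + 2 p⁰ q₀ N(X) + p⁰² |N(t)|² s³) / (2 N(Y))`. The mixed
term is constant, so stationarity at `s = 1` balances the other two. -/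
theorem scaling_attractor_equation (p0 q0 : ℝ) {t : Sym2 (Fin 3) → ℂ}
    (hn : nrm (imPart t) ≠ 0)
    (ht : HasFDerivAt (effPotential (chargeD0D6 p0 q0)) (0 : (Sym2 (Fin 3) → ℂ) →L[ℝ] ℝ) t) :
    q0 ^ 2 = p0 ^ 2 * Complex.normSq (nrm t) := by
  have h1 := ht.hasDerivAt_add_smul t
  have key : (fun h : ℝ => effPotential (chargeD0D6 p0 q0) (t + h • t)) =ᶠ[nhds 0] fun h =>
      (q0 ^ 2 + 2 * p0 * q0 * ((1 + h) ^ 3 * nrm (rePart t)) + p0 ^ 2 * ((1 + h) ^ 6 *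
        Complex.normSq (nrm t))) / (2 * ((1 + h) ^ 3 * nrm (imPart t))) := by
    have hc : ContinuousAt (fun h : ℝ => 1 + h) 0 := by fun_prop
    filter_upwards [hc.eventually_ne (y := 0) (by norm_num)] with h hh
    have e1 : imPart (t + h • t) = fun i => (1 + h) * imPart t i := by
      ext i; simp [imPart]; ring
    have e2 : rePart (t + h • t) = fun i => (1 + h) * rePart t i := by
      ext i; simp [rePart]; ring
    have e3 : t + h • t = fun i => ((1 + h : ℝ) : ℂ) * t i := by
      ext i; simp; ring
    rw [effPotential_chargeD0D6, e1, e2, nrm_smul, nrm_smul, e3, nrm_smul]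
    · rw [map_mul, map_pow, Complex.normSq_ofReal]
      ring
    · rw [e1, nrm_smul]; exact mul_ne_zero (pow_ne_zero _ hh) hn
  have h2 := h1.congr_of_eventuallyEq key.symm
  have hid : HasDerivAt (fun h : ℝ => 1 + h) 1 0 := by
    simpa using (hasDerivAt_id (0 : ℝ)).const_add 1
  have h3 := ((((hid.pow 3).mul_const (nrm (rePart t))).const_mul (2 * p0 * q0)).const_add
    (q0 ^ 2)).add (((hid.pow 6).mul_const (Complex.normSq (nrm t))).const_mul (p0 ^ 2))
  have h4 := h3.div (((hid.pow 3).mul_const (nrm (imPart t))).const_mul 2) (by simpa using hn)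
  have h5 := h2.unique h4
  simp only [Pi.add_apply, Pi.pow_apply, add_zero, one_pow, zero_apply] at h5
  rw [eq_comm, div_eq_zero_iff] at h5
  have h6 := h5.resolve_right (by simpa using hn)
  have : 6 * nrm (imPart t) * (p0 ^ 2 * Complex.normSq (nrm t) - q0 ^ 2) = 0 := by
    norm_num at h6
    linear_combination h6
  simp only [mul_eq_zero, hn, OfNat.ofNat_ne_zero, false_or] at this
  linarith

theorem hasDerivAt_quadratic (A B C E x m n : ℝ) :
    HasDerivAt (fun h : ℝ => (A + B * ((x + h) * m) + C * (((x + h) ^ 2 + 1) * n)) / E)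
      ((B * m + 2 * C * x * n) / E) 0 := by
  have hid : HasDerivAt (fun h : ℝ => x + h) 1 0 := by
    simpa using (hasDerivAt_id (0 : ℝ)).const_add x
  refine (((((hid.mul_const m).const_mul B).const_add A).add
    ((((hid.pow 2).add_const 1).mul_const n).const_mul C)).div_const E).congr_deriv ?_
  simp
  ring

theorem locusC_of_attractor {p0 q0 : ℝ} (hp0 : p0 ≠ 0) {Z : Siegel 3}
    (hZ : Z ∈ attractorLocus (chargeD0D6 p0 q0)) : Z ∈ locusC p0 q0 := by
  have hXs : (Z.1.map Complex.re).IsSymm := by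
    rw [← symMatrix_rePart_coords]; exact symMatrix_isSymm _
  obtain ⟨S, d, hS, hY, hX⟩ := exists_simultaneous_diagonalization hXs Z.2.2
  have him : symMatrix (imPart (coords Z)) = S * Sᵀ := hY
  have hre : symMatrix (rePart (coords Z)) = S * Matrix.diagonal d * Sᵀ := hX
  have hZ' : HasFDerivAt (effPotential (chargeD0D6 p0 q0))
    (0 : (Sym2 (Fin 3) → ℂ) →L[ℝ] ℝ) (coords Z) := hZ
  have hn : nrm (imPart (coords Z)) = S.det ^ 2 :=
    (effPotential_of_diagonalization p0 q0 hS him hre).2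
  have hD : S.det ^ 2 ≠ 0 := pow_ne_zero 2 hS
  have hs := scaling_attractor_equation p0 q0 (by rw [hn]; exact hD) hZ'
  rw [(nrm_of_diagonalization him hre), map_mul, map_pow, map_mul, map_mul, Complex.normSq_ofReal,
    normSq_add_I, normSq_add_I, normSq_add_I] at hs
  -- In each `d_k = x` the potential is quadratic, with `m` the product of the other two eigenvalues
  -- and `n` the product of their `d² + 1`.
  have heq : ∀ {x m n : ℝ} {k : Fin 3},
      (∀ h : ℝ, diagPotential p0 q0 S.det (d + h • (Pi.single k 1 : Fin 3 → ℝ)) =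
        (q0 ^ 2 + (2 * p0 * q0 * S.det ^ 2) * ((x + h) * m) +
          (p0 ^ 2 * S.det ^ 4) * (((x + h) ^ 2 + 1) * n)) / (2 * S.det ^ 2)) →
      q0 * m + p0 * S.det ^ 2 * (x * n) = 0 := by
    intro x m n k h
    have h1 := hasDerivAt_diagPotential p0 q0 hZ' hS him hre k
    rw [funext h] at h1
    have h2 := (hasDerivAt_quadratic _ _ _ _ _ _ _).unique h1
    rw [div_eq_zero_iff] at h2
    have h3 := h2.resolve_right (mul_ne_zero two_ne_zero hD)
    have h4 : 2 * p0 * S.det ^ 2 * (q0 * m + p0 * S.det ^ 2 * (x * n)) = 0 := by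
      linear_combination h3
    exact (mul_eq_zero.1 h4).resolve_left (mul_ne_zero (mul_ne_zero two_ne_zero hp0) hD)
  obtain ⟨h0, h1, h2⟩ := eq_zero_of_attractor_equations hp0 hD
    (heq (k := 0) (x := d 0) (m := d 1 * d 2) (n := (d 1 ^ 2 + 1) * (d 2 ^ 2 + 1))
      fun h => by simp [diagPotential]; ring)
    (heq (k := 1) (x := d 1) (m := d 0 * d 2) (n := (d 0 ^ 2 + 1) * (d 2 ^ 2 + 1))
      fun h => by simp [diagPotential]; ring)
    (heq (k := 2) (x := d 2) (m := d 0 * d 1) (n := (d 0 ^ 2 + 1) * (d 1 ^ 2 + 1))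
      fun h => by simp [diagPotential]; ring)
    (by rw [hs]; ring)
  have hd : d = 0 := by ext i; fin_cases i <;> assumption
  refine ⟨by rw [← symMatrix_rePart_coords, hre, hd]; simp, ?_⟩
  rw [← symMatrix_imPart_coords, det_symMatrix, hn]
  have h3 : (q0 / p0) ^ 2 = (S.det ^ 2) ^ 2 := by
    rw [h0, h1, h2] at hs
    field_simp
    rw [hs]; ring
  rw [← Real.sqrt_sq_eq_abs, h3, Real.sqrt_sq (sq_nonneg _)]

/-! ### The minimum of the effective potential -/

theorem coords_im_pos {Z : Siegel 3} : 0 < nrm (imPart (coords Z)) := by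
  rw [← det_symMatrix]; exact Z.2.2.det_pos

/-- With `P = d₀ d₁ d₂` and `D = (det S)²`, bound `∏ (d_k² + 1)` below by `(1 + |P|)²` and apply the
inequality of means to `|q₀|` and `|p⁰| D (1 + |P|)`. The excess `2 |p⁰ q₀| D |P|` absorbs the mixed
term. -/
theorem abs_mul_le_effPotential (p0 q0 : ℝ) {t : Sym2 (Fin 3) → ℂ}
    (ht : (symMatrix (imPart t)).PosDef) :
    |p0 * q0| ≤ effPotential (chargeD0D6 p0 q0) t := by
  obtain ⟨S, d, hS, him, hre⟩ :=
    exists_simultaneous_diagonalization (symMatrix_isSymm (rePart t)) ht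
  rw [(effPotential_of_diagonalization p0 q0 hS him hre).1]
  have hD : 0 < S.det ^ 2 := by positivity
  rw [le_div_iff₀ (by positivity)]
  set P := d 0 * d 1 * d 2 with hP
  have h1 : (1 + |P|) ^ 2 ≤ (d 0 ^ 2 + 1) * (d 1 ^ 2 + 1) * (d 2 ^ 2 + 1) := by
    -- Only two of the middle terms of the expanded product are needed for the cross term `2 |P|`.
    have h2 : 2 * |P| ≤ d 0 ^ 2 + (d 1 * d 2) ^ 2 := by
      rw [hP, mul_assoc, abs_mul, ← sq_abs (d 0), ← sq_abs (d 1 * d 2)]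
      nlinarith [sq_nonneg (|d 0| - |d 1 * d 2|)]
    have h3 : |P| ^ 2 = (d 0 * d 1 * d 2) ^ 2 := by rw [sq_abs]
    nlinarith [sq_nonneg (d 1), sq_nonneg (d 2), sq_nonneg (d 0 * d 1), sq_nonneg (d 0 * d 2)]
  have h2 : p0 ^ 2 * (S.det ^ 4 * (1 + |P|) ^ 2) ≤ p0 ^ 2 * (S.det ^ 4 *
      ((d 0 ^ 2 + 1) * (d 1 ^ 2 + 1) * (d 2 ^ 2 + 1))) := by gcongr
  have h3 : -(|p0 * q0| * |P|) ≤ p0 * q0 * P := by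
    rw [← abs_mul]; exact neg_abs_le _
  have h4 : 0 ≤ (|q0| - |p0| * S.det ^ 2 * (1 + |P|)) ^ 2 := sq_nonneg _
  have h5 : S.det ^ 2 * -(|p0 * q0| * |P|) ≤ S.det ^ 2 * (p0 * q0 * P) := by gcongr
  rw [sub_sq, sq_abs, mul_pow, mul_pow, sq_abs] at h4
  rw [abs_mul] at h5 ⊢
  nlinarith

/-- On `C_Q` one has `N(X) = 0` and `N(iY) = -i N(Y)`, so the lower bound `|p⁰ q₀|` is attained.
Differentiability is read off from the explicit formula, which holds near the point. -/
theorem attractor_of_locusC {p0 q0 : ℝ} (hp0 : p0 ≠ 0) (hq0 : q0 ≠ 0) {Z : Siegel 3}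
    (hZ : Z ∈ locusC p0 q0) : Z ∈ attractorLocus (chargeD0D6 p0 q0) := by
  obtain ⟨hre, him⟩ := hZ
  rw [← symMatrix_imPart_coords, det_symMatrix] at him
  rw [← symMatrix_rePart_coords] at hre
  set t := coords Z with ht
  have hn : 0 < nrm (imPart t) := coords_im_pos
  have hev : effPotential (chargeD0D6 p0 q0) =ᶠ[nhds t] fun t =>
      (q0 ^ 2 + 2 * p0 * q0 * nrm (rePart t) + p0 ^ 2 * Complex.normSq (nrm t)) /
        (2 * nrm (imPart t)) := by
    filter_upwards [continuous_nrm_imPart.continuousAt.eventually_ne hn.ne'] with s hs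
    exact effPotential_chargeD0D6 p0 q0 hs
  have hval : effPotential (chargeD0D6 p0 q0) t = |p0 * q0| := by
    have hr : rePart t = 0 := by
      ext i
      induction i using Sym2.ind with
      | _ a b => exact congrFun (congrFun hre a) b
    have h1 : nrm t = -Complex.I * ((nrm (imPart t) : ℝ) : ℂ) := by
      have e : t = fun i => Complex.I * imC t i := by
        ext i
        have := congrFun hr i
        simp only [rePart, Pi.zero_apply] at this
        apply Complex.ext <;> simp [imC, imPart, this]
      conv_lhs => rw [e]
      rw [nrm_smul, nrm_imC, Complex.I_pow_three]
    rw [effPotential_chargeD0D6 p0 q0 hn.ne', h1, hr, him]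
    have h2 : nrm (0 : Sym2 (Fin 3) → ℝ) = 0 := by simp [nrm]
    rw [h2, map_mul, Complex.normSq_ofReal, Complex.normSq_neg, Complex.normSq_I, abs_div, abs_mul]
    have h3 : |p0| ≠ 0 := abs_ne_zero.2 hp0
    have h4 : |q0| ≠ 0 := abs_ne_zero.2 hq0
    rw [← sq_abs q0, ← sq_abs p0]
    field_simp
    ring
  have hmin : IsLocalMin (effPotential (chargeD0D6 p0 q0)) t := by
    have hc : Continuous imPart := imCoordsCLM.continuous
    have : ∀ᶠ s in nhds t, (symMatrix (imPart s)).PosDef :=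
      (isOpen_setOf_posDef_symMatrix.preimage hc).mem_nhds Z.2.2
    filter_upwards [this] with s hs
    rw [hval]
    exact abs_mul_le_effPotential p0 q0 hs
  have hdiff : DifferentiableAt ℝ (effPotential (chargeD0D6 p0 q0)) t := by
    rw [hev.differentiableAt_iff]
    have h1 : ∀ i, Differentiable ℝ fun t : Sym2 (Fin 3) → ℂ => (t i).re := fun i =>
      Complex.reCLM.differentiable.comp (differentiable_apply i)
    have h2 : ∀ i, Differentiable ℝ fun t : Sym2 (Fin 3) → ℂ => (t i).im := fun i =>
      Complex.imCLM.differentiable.comp (differentiable_apply i)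
    have h3 : Differentiable ℝ fun t : Sym2 (Fin 3) → ℂ => nrm (rePart t) := by
      unfold nrm rePart; fun_prop
    have h4 : Differentiable ℝ fun t : Sym2 (Fin 3) → ℂ => nrm (imPart t) := by
      unfold nrm imPart; fun_prop
    have h5 : Differentiable ℝ fun t : Sym2 (Fin 3) → ℂ => nrm t := by
      unfold nrm; fun_prop
    have h6 : Differentiable ℝ fun t : Sym2 (Fin 3) → ℂ => Complex.normSq (nrm t) := by
      simp only [Complex.normSq_apply]
      have hr : Differentiable ℝ fun t : Sym2 (Fin 3) → ℂ => (nrm t).re :=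
        Complex.reCLM.differentiable.comp h5
      have hi : Differentiable ℝ fun t : Sym2 (Fin 3) → ℂ => (nrm t).im :=
        Complex.imCLM.differentiable.comp h5
      fun_prop
    have h7 := h4.const_mul 2
    have h8 : Differentiable ℝ fun t : Sym2 (Fin 3) → ℂ => q0 ^ 2 +
        2 * p0 * q0 * nrm (rePart t) + p0 ^ 2 * Complex.normSq (nrm t) := by fun_prop
    have h9 : 2 * nrm (imPart t) ≠ 0 := mul_ne_zero two_ne_zero hn.ne'
    simp only [div_eq_mul_inv]
    exact (h8 t).fun_mul ((h7 t).fun_inv h9)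
  have h0 := hdiff.hasFDerivAt
  rwa [hmin.hasFDerivAt_eq_zero h0] at h0

theorem attractorLocus_chargeD0D6 {p0 q0 : ℝ} (hp0 : p0 ≠ 0) (hq0 : q0 ≠ 0) :
    attractorLocus (chargeD0D6 p0 q0) = locusC p0 q0 :=
  Set.Subset.antisymm (fun _ hZ => locusC_of_attractor hp0 hZ)
    fun _ hZ => attractor_of_locusC hp0 hq0 hZ

/-! ## The action on the Siegel space is continuous and properly discontinuous -/

theorem continuous_val_siegel {n : ℕ} : Continuous fun Z : Siegel n => Z.1 :=
  continuous_subtype_val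

theorem continuous_num {n : ℕ} (g : Sp n) : Continuous fun Z : Siegel n => num g Z.1 := by
  unfold num
  exact (continuous_const.matrix_mul continuous_val_siegel).add continuous_const

theorem continuous_den {n : ℕ} (g : Sp n) : Continuous fun Z : Siegel n => den g Z.1 := by
  unfold den
  exact (continuous_const.matrix_mul continuous_val_siegel).add continuous_const

theorem Continuous.matrix_inv_of_det_ne_zero {X n 𝕜 : Type*} [TopologicalSpace X] [Fintype n]
    [DecidableEq n] [NormedField 𝕜] {f : X → Matrix n n 𝕜} (hf : Continuous f)
    (h : ∀ x, (f x).det ≠ 0) : Continuous fun x => (f x)⁻¹ := by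
  simp only [Matrix.inv_def, Ring.inverse_eq_inv']
  exact (hf.matrix_det.inv₀ h).smul hf.matrix_adjugate

theorem smul_val {n : ℕ} (g : Sp n) (Z : Siegel n) :
    (g • Z).1 = num g Z.1 * (den g Z.1)⁻¹ := rfl

theorem isUnit_det_den {n : ℕ} (g : Sp n) (Z : Siegel n) : IsUnit (den g Z.1).det :=
  (Matrix.isUnit_iff_isUnit_det _).1 (isUnit_den g Z)

instance {n : ℕ} : ContinuousConstSMul (Sp n) (Siegel n) where
  continuous_const_smul g := by
    refine Continuous.subtype_mk ((continuous_num g).matrix_mul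
      ((continuous_den g).matrix_inv_of_det_ne_zero fun Z => (isUnit_det_den g Z).ne_zero)) _

theorem smul_val_mul_den {n : ℕ} (g : Sp n) (Z : Siegel n) :
    (g • Z).1 * den g Z.1 = num g Z.1 := by
  rw [smul_val, Matrix.nonsing_inv_mul_cancel_right _ _ (isUnit_det_den g Z)]

/-- The transformation law of `Im Z`. It bounds `CZ + D` in the proof of proper discontinuity, and
its determinant compares `det Y` along an orbit. -/
theorem den_conjTranspose_mul_im_smul_mul_den {n : ℕ} (g : Sp n) (Z : Siegel n) :
    (den g Z.1)ᴴ * (((g • Z).1.map Complex.im).map Complex.ofReal * den g Z.1) =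
      (Z.1.map Complex.im).map Complex.ofReal := by
  have h := den_conjTranspose_mul_num g Z.1
  rw [← smul_val_mul_den, Matrix.conjTranspose_mul, Matrix.mul_assoc, ← Matrix.mul_sub,
    ← Matrix.sub_mul, sub_conjTranspose_of_isSymm (g • Z).2.1, sub_conjTranspose_of_isSymm Z.2.1,
    Matrix.smul_mul, Matrix.mul_smul] at h
  have h3 : (2 * Complex.I) ≠ 0 := by simp
  exact smul_right_injective _ h3 h

/-- On a compact subset of the Siegel space, the imaginary parts are bounded below. -/
theorem exists_pos_le_im {n : ℕ} {L : Set (Siegel n)} (hL : IsCompact L) :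
    ∃ c : ℝ, 0 < c ∧ ∀ W ∈ L, ∀ v : Fin n → ℂ,
      c * ‖v‖ ^ 2 ≤ (star v ⬝ᵥ ((W.1.map Complex.im).map Complex.ofReal *ᵥ v)).re := by
  have hcont : Continuous fun p : Siegel n × (Fin n → ℂ) =>
      (star p.2 ⬝ᵥ ((p.1.1.map Complex.im).map Complex.ofReal *ᵥ p.2)).re := by
    refine Complex.continuous_re.comp (Continuous.dotProduct continuous_snd.star
      (Continuous.matrix_mulVec ?_ continuous_snd))
    exact ((continuous_val_siegel.comp continuous_fst).matrix_map Complex.continuous_im).matrix_map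
      Complex.continuous_ofReal
  -- A positive continuous function on the compact product of `L` with the unit sphere has a
  -- positive lower bound; homogeneity extends it to all vectors.
  obtain ⟨c, hc, h⟩ := (hL.prod (isCompact_sphere (0 : Fin n → ℂ) 1)).exists_forall_le'
    hcont.continuousOn (a := 0) fun p hp =>
      star_dotProduct_map_ofReal_pos (isSymm_map_im p.1.2.1) p.1.2.2
        (Metric.ne_of_mem_sphere hp.2 one_ne_zero)
  refine ⟨c, hc, fun W hW v => ?_⟩
  rcases eq_or_ne v 0 with rfl | hv
  · simp
  have hv' : ‖v‖ ≠ 0 := norm_ne_zero_iff.2 hv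
  have h1 := h (W, (‖v‖⁻¹ : ℂ) • v) ⟨hW, by simp [norm_smul, hv']⟩
  simp only [star_smul, Matrix.mulVec_smul, smul_dotProduct, dotProduct_smul, smul_eq_mul] at h1
  rw [← mul_assoc, show (‖v‖⁻¹ : ℂ) * star (‖v‖⁻¹ : ℂ) = (((‖v‖ ^ 2)⁻¹ : ℝ) : ℂ) by
    simp [pow_two], Complex.re_ofReal_mul] at h1
  rwa [inv_mul_eq_div, le_div_iff₀ (by positivity)] at h1

/-- Boundedness of all entries of a family of matrices along a filter. -/
def EntrywiseBounded {ι m n 𝕜 : Type*} [Norm 𝕜] (l : Filter ι) (M : ι → Matrix m n 𝕜) : Prop :=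
  ∀ i j, (fun x => M x i j) =O[l] fun _ => (1 : ℝ)

theorem EntrywiseBounded.mul {ι m n k 𝕜 : Type*} [Fintype n] [NormedField 𝕜] {l : Filter ι}
    {M : ι → Matrix m n 𝕜} {N : ι → Matrix n k 𝕜} (hM : EntrywiseBounded l M)
    (hN : EntrywiseBounded l N) : EntrywiseBounded l fun x => M x * N x := by
  intro i j
  have h : ∀ k, (fun x => M x i k * N x k j) =O[l] fun _ => (1 : ℝ) := fun k => by
    simpa using (hM i k).mul (hN k j)
  have h1 := IsBigO.fun_sum (s := Finset.univ) fun k _ => h k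
  simpa only [Matrix.mul_apply] using h1

theorem EntrywiseBounded.sub {ι m n 𝕜 : Type*} [NormedField 𝕜] {l : Filter ι}
    {M N : ι → Matrix m n 𝕜} (hM : EntrywiseBounded l M)
    (hN : EntrywiseBounded l N) : EntrywiseBounded l fun x => M x - N x :=
  fun i j => (hM i j).sub (hN i j)

theorem EntrywiseBounded.of_isCompact {ι T m n 𝕜 : Type*} [TopologicalSpace T] [NormedField 𝕜]
    {K : Set T} (hK : IsCompact K) {f : T → Matrix m n 𝕜} (hf : Continuous f)
    {S : Set ι} {φ : ι → T} (h : ∀ x ∈ S, φ x ∈ K) :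
    EntrywiseBounded (𝓟 S) fun x => f (φ x) := by
  intro i j
  obtain ⟨C, hC⟩ := hK.exists_bound_of_continuousOn (hf.matrix_elem i j).continuousOn
  exact IsBigO.of_bound C (eventually_principal.2 fun x hx => by simpa using hC _ (h x hx))

theorem finite_of_entrywiseBounded {n : ℕ} {S : Set (Sp n × Siegel n)}
    (h : EntrywiseBounded (𝓟 S) fun p => cplx p.1) : (Prod.fst '' S).Finite := by
  have h1 : ∀ i j, ∃ R : ℤ, ∀ p ∈ S, p.1.1 i j ∈ Set.Icc (-R) R := by
    intro i j
    obtain ⟨C, hC⟩ := (h i j).bound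
    refine ⟨⌈C⌉, fun p hp => ?_⟩
    have h2 := eventually_principal.1 hC p hp
    simp only [cplx, Matrix.map_apply, eq_intCast, Complex.norm_intCast, norm_one, mul_one] at h2
    have h3 := abs_le.1 (h2.trans (Int.le_ceil C))
    exact ⟨by exact_mod_cast h3.1, by exact_mod_cast h3.2⟩
  choose R hR using h1
  have h2 : (Set.pi Set.univ fun i => Set.pi Set.univ fun j => Set.Icc (-R i j) (R i j)).Finite :=
    Set.Finite.pi fun i => Set.Finite.pi fun j => Set.finite_Icc _ _
  refine Set.Finite.of_finite_image (f := fun g : Sp n => g.1) (h2.subset ?_)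
    Subtype.val_injective.injOn
  rintro _ ⟨_, ⟨p, hp, rfl⟩, rfl⟩ i - j -
  exact hR i j p hp

theorem map_im_real_mul {n : ℕ} (A : Matrix (Fin n) (Fin n) ℤ) (Z : Matrix (Fin n) (Fin n) ℂ) :
    (A.map (Int.castRingHom ℂ) * Z).map Complex.im =
      A.map (Int.castRingHom ℝ) * Z.map Complex.im := by
  ext i j
  simp [Matrix.mul_apply]

/-- If `A Z + B` and `Z` are bounded, with `A`, `B` integral and `(Im Z)⁻¹` bounded, then so are
`A` and `B`. -/
theorem entrywiseBounded_blocks {n : ℕ} {ι : Type*} {l : Filter ι} {Z : ι → Siegel n}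
    {A B : ι → Matrix (Fin n) (Fin n) ℤ}
    (hZ : EntrywiseBounded l fun x => (Z x).1)
    (hY : EntrywiseBounded l fun x => ((Z x).1.map Complex.im)⁻¹)
    (h : EntrywiseBounded l fun x => (A x).map (Int.castRingHom ℂ) * (Z x).1 +
      (B x).map (Int.castRingHom ℂ)) :
    EntrywiseBounded l (fun x => (A x).map (Int.castRingHom ℂ)) ∧
      EntrywiseBounded l fun x => (B x).map (Int.castRingHom ℂ) := by
  have h1 : EntrywiseBounded l fun x => (A x).map (Int.castRingHom ℝ) := by
    -- Taking imaginary parts of `A Z + B` isolates `A · Im Z`, as `A` and `B` are real.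
    have e : (fun x => (A x).map (Int.castRingHom ℝ)) = fun x => ((A x).map (Int.castRingHom ℂ) *
        (Z x).1 + (B x).map (Int.castRingHom ℂ)).map Complex.im * ((Z x).1.map Complex.im)⁻¹ := by
      funext x
      have hu : IsUnit ((Z x).1.map Complex.im).det := (Z x).2.2.det_pos.ne'.isUnit
      rw [Matrix.map_add _ Complex.add_im, map_im_real_mul]
      have : ((B x).map (Int.castRingHom ℂ)).map Complex.im = 0 := by ext i j; simp
      rw [this, add_zero, Matrix.mul_nonsing_inv_cancel_right _ _ hu]
    rw [e]
    refine EntrywiseBounded.mul (fun i j => ?_) hY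
    exact (IsBigO.of_bound 1 (Eventually.of_forall fun x => by
      rw [one_mul]; exact Complex.abs_im_le_norm _)).trans (h i j)
  have h2 : EntrywiseBounded l fun x => (A x).map (Int.castRingHom ℂ) := fun i j =>
    (IsBigO.of_bound 1 (Eventually.of_forall fun x => by simp)).trans (h1 i j)
  refine ⟨h2, ?_⟩
  have h3 := h.sub (h2.mul hZ)
  simpa using h3

/-- If `Z ∈ K` and `gZ ∈ L`, the column `u = (CZ + D) eⱼ` satisfies `u* Im(gZ) u = Im Zⱼⱼ`, so it is
bounded. Then `AZ + B = (gZ)(CZ + D)` is bounded, hence so are the integral blocks of `g`, and only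
finitely many `g` remain. -/
instance {n : ℕ} : ProperlyDiscontinuousSMul (Sp n) (Siegel n) where
  finite_disjoint_inter_image {K L} hK hL := by
    let S : Set (Sp n × Siegel n) := {p | p.2 ∈ K ∧ p.1 • p.2 ∈ L}
    have hS : {g : Sp n | ((g • ·) '' K ∩ L).Nonempty} = Prod.fst '' S := by
      ext g
      constructor
      · rintro ⟨_, ⟨Z, hZ, rfl⟩, hW⟩
        exact ⟨(g, Z), ⟨hZ, hW⟩, rfl⟩
      · rintro ⟨p, ⟨hZ, hW⟩, rfl⟩
        exact ⟨_, ⟨p.2, hZ, rfl⟩, hW⟩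
    rw [hS]
    refine finite_of_entrywiseBounded ?_
    have hZ : EntrywiseBounded (𝓟 S) fun p => p.2.1 :=
      .of_isCompact hK continuous_val_siegel (φ := Prod.snd) fun _ hp => hp.1
    have hW : EntrywiseBounded (𝓟 S) fun p => (p.1 • p.2).1 :=
      .of_isCompact hL continuous_val_siegel (φ := fun p : Sp n × Siegel n => p.1 • p.2)
        fun _ hp => hp.2
    have hY : EntrywiseBounded (𝓟 S) fun p => (p.2.1.map Complex.im)⁻¹ :=
      .of_isCompact hK ((continuous_val_siegel.matrix_map
        Complex.continuous_im).matrix_inv_of_det_ne_zero fun Z => Z.2.2.det_pos.ne')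
        (φ := Prod.snd) fun _ hp => hp.1
    have hden : EntrywiseBounded (𝓟 S) fun p => den p.1 p.2.1 := by
      obtain ⟨c, hc, hcL⟩ := exists_pos_le_im hL
      intro i j
      obtain ⟨C, hC⟩ := (hZ j j).bound
      refine IsBigO.of_bound (Real.sqrt (C / c)) (eventually_principal.2 fun p hp => ?_)
      have hb := eventually_principal.1 hC p hp
      set u := den p.1 p.2.1 *ᵥ Pi.single j 1 with hu
      have h1 := hcL _ hp.2 u
      have h2 := congrArg (fun M => star (Pi.single j (1 : ℂ)) ⬝ᵥ (M *ᵥ Pi.single j 1))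
        (den_conjTranspose_mul_im_smul_mul_den p.1 p.2)
      simp only [← Matrix.mulVec_mulVec] at h2
      rw [Matrix.dotProduct_mulVec, ← Matrix.star_mulVec, ← hu] at h2
      rw [h2] at h1
      have h3 : ‖den p.1 p.2.1 i j‖ ≤ ‖u‖ := by
        have := norm_le_pi_norm u i
        rw [hu, Matrix.mulVec_single_one] at this ⊢
        exact this
      have h4 : c * ‖u‖ ^ 2 ≤ C := by
        refine h1.trans ?_
        have h5 : (star (Pi.single j (1 : ℂ)) ⬝ᵥ
            ((p.2.1.map Complex.im).map Complex.ofReal *ᵥ Pi.single j 1)).re = (p.2.1 j j).im := by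
          rw [Matrix.mulVec_single_one, ← Pi.single_star, single_dotProduct]
          simp
        rw [h5]
        refine (le_abs_self _).trans ((Complex.abs_im_le_norm _).trans ?_)
        simpa using hb
      simp only [norm_one, mul_one]
      refine h3.trans (Real.le_sqrt_of_sq_le ?_)
      rw [le_div_iff₀ hc]
      linarith
    have hnum : EntrywiseBounded (𝓟 S) fun p => num p.1 p.2.1 := by
      have := hW.mul hden
      simpa only [smul_val_mul_den] using this
    obtain ⟨h11, h12⟩ := entrywiseBounded_blocks (A := fun p : Sp n × Siegel n => p.1.1.toBlocks₁₁)
      (B := fun p => p.1.1.toBlocks₁₂) hZ hY hnum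
    obtain ⟨h21, h22⟩ := entrywiseBounded_blocks (A := fun p : Sp n × Siegel n => p.1.1.toBlocks₂₁)
      (B := fun p => p.1.1.toBlocks₂₂) hZ hY hden
    rintro (i | i) (j | j)
    exacts [h11 i j, h12 i j, h21 i j, h22 i j]

/-! ## The congruence subgroup of level four acts freely -/

/-- The determinant of `A` is odd, hence nonzero, and multiplication by the adjugate cancels `A`. -/
theorem eq_zero_of_odd_det_mul {n : Type*} [Fintype n] [DecidableEq n] {A B : Matrix n n ℤ}
    (hA : A.map (Int.castRingHom (ZMod 2)) = 1) (h : A * B = 0) : B = 0 := by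
  have hd : A.det ≠ 0 := by
    intro h0
    have h1 := congrArg Matrix.det hA
    rw [← RingHom.mapMatrix_apply, ← RingHom.map_det, h0] at h1
    simp at h1
  have h1 : A.adjugate * (A * B) = 0 := by rw [h, Matrix.mul_zero]
  rw [← Matrix.mul_assoc, Matrix.adjugate_mul, Matrix.smul_mul, Matrix.one_mul] at h1
  exact (smul_eq_zero.1 h1).resolve_left hd

/-- An integral matrix of finite order that is congruent to the identity modulo four is the
identity. -/
theorem eq_one_of_pow_eq_one_of_congr {n : Type*} [Fintype n] [DecidableEq n]
    {M C : Matrix n n ℤ} (hM : M = 1 + (4 : ℤ) • C) {k : ℕ} (hk : k ≠ 0) (h : M ^ k = 1) :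
    M = 1 := by
  have h2 : ∀ (r : ℤ) (hr : ((r : ℤ) : ZMod 2) = 0) (C : Matrix n n ℤ),
      (r • C).map (Int.castRingHom (ZMod 2)) = 0 := by
    intro r hr C
    ext i j
    simp only [Matrix.map_apply, Matrix.smul_apply, smul_eq_mul, map_mul, eq_intCast, hr, zero_mul,
      Matrix.zero_apply]
  have hM2 : M.map (Int.castRingHom (ZMod 2)) = 1 := by
    rw [hM, Matrix.map_add _ (map_add _), h2 4 (by decide)]
    simp
  -- Factor `0 = N² - 1 = 2 (1 + 2D)(N - 1)`. The middle factor is `1` modulo `2` and can be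
  -- cancelled; this is where level `4` is needed.
  have hsq : ∀ {N D : Matrix n n ℤ}, N = 1 + (4 : ℤ) • D → N ^ 2 = 1 → N = 1 := by
    intro N D hN hN2
    have h3 : (1 + (2 : ℤ) • D) * (N - 1) = 0 := by
      have h4 : (2 : ℤ) • ((1 + (2 : ℤ) • D) * (N - 1)) = 0 := by
        rw [← Matrix.smul_mul]
        have : (2 : ℤ) • (1 + (2 : ℤ) • D) = N + 1 := by rw [hN]; module
        rw [this, ← sub_eq_zero.2 hN2]
        noncomm_ring
      exact (smul_eq_zero.1 h4).resolve_left two_ne_zero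
    exact sub_eq_zero.1 (eq_zero_of_odd_det_mul
      (by rw [Matrix.map_add _ (map_add _), h2 2 (by decide)]; simp) h3)
  induction k using Nat.strong_induction_on with
  | _ k ih =>
    -- An even exponent is halved by `hsq`. For an odd one, the geometric sum has an odd number of
    -- terms, so it is `1` modulo `2` and cancels.
    rcases Nat.even_or_odd' k with ⟨m, rfl | rfl⟩
    · have hm : m ≠ 0 := by omega
      refine ih m (by omega) hm ?_
      have hD : ∀ j : ℕ, ∃ D, M ^ j = 1 + (4 : ℤ) • D := by
        intro j
        induction j with
        | zero => exact ⟨0, by simp⟩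
        | succ j ihj =>
          obtain ⟨D, hD⟩ := ihj
          refine ⟨C + D + (4 : ℤ) • (D * C), ?_⟩
          rw [pow_succ, hD, hM]
          simp only [add_mul, mul_add, Matrix.smul_mul, Matrix.mul_smul, one_mul, mul_one]
          module
      obtain ⟨D, hD⟩ := hD m
      exact hsq hD (by rw [← pow_mul, mul_comm, h])
    · have h3 : (∑ i ∈ Finset.range (2 * m + 1), M ^ i) * (M - 1) = 0 := by
        rw [geom_sum_mul, h, sub_self]
      refine sub_eq_zero.1 (eq_zero_of_odd_det_mul ?_ h3)
      rw [← RingHom.mapMatrix_apply, map_sum]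
      simp only [map_pow, RingHom.mapMatrix_apply, hM2, one_pow, Finset.sum_const,
        Finset.card_range]
      rw [add_smul, mul_smul, one_smul]
      have : (2 : ℕ) • (m • (1 : Matrix n n (ZMod 2))) = 0 := by
        rw [two_nsmul]
        ext i j
        simpa using CharTwo.add_self_eq_zero _
      rw [this, zero_add]

theorem eq_one_add_smul_of_mem_Gam {n N : ℕ} {g : Sp n} (hg : g ∈ Gam n N) :
    ∃ C, g.1 = 1 + (N : ℤ) • C := by
  have hg' : g.1.map (Int.castRingHom (ZMod N)) = 1 := hg
  have h : ∀ i j, (N : ℤ) ∣ (g.1 - 1) i j := by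
    intro i j
    rw [← ZMod.intCast_zmod_eq_zero_iff_dvd, Matrix.sub_apply, Int.cast_sub]
    have h1 := congrFun (congrFun hg' i) j
    simp only [Matrix.map_apply, eq_intCast] at h1
    rw [h1, Matrix.one_apply, Matrix.one_apply]
    split_ifs <;> simp
  choose C hC using h
  refine ⟨Matrix.of C, ?_⟩
  ext i j
  have := hC i j
  simp only [Matrix.sub_apply] at this
  simp only [Matrix.add_apply, Matrix.smul_apply, Matrix.of_apply, smul_eq_mul]
  linarith

theorem eq_one_of_mem_Gam_four_of_smul_eq {n : ℕ} {g : Sp n} (hg : g ∈ Gam n 4) {Z : Siegel n}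
    (h : g • Z = Z) : g = 1 := by
  have hfin : Finite (MulAction.stabilizer (Sp n) Z) :=
    (ProperlyDiscontinuousSMul.finite_stabilizer Z).to_subtype
  obtain ⟨k, hk, hgk⟩ :=
    (isOfFinOrder_of_finite (⟨g, h⟩ : MulAction.stabilizer (Sp n) Z)).exists_pow_eq_one
  have hgk' : g ^ k = 1 := congrArg Subtype.val hgk
  obtain ⟨C, hC⟩ := eq_one_add_smul_of_mem_Gam hg
  refine Subtype.ext (eq_one_of_pow_eq_one_of_congr hC hk.ne' ?_)
  simpa using congrArg Subtype.val hgk'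

/-! ### The involution `τ` and the elements of `Γ(4)` joining its fixed points -/

theorem tau_tau {n : ℕ} (Z : Siegel n) : tau (tau Z) = Z := by
  apply Subtype.ext
  ext i j
  simp [tau]

theorem continuous_tau {n : ℕ} : Continuous (tau : Siegel n → Siegel n) :=
  Continuous.subtype_mk (continuous_val_siegel.matrix_map Complex.continuous_conj).neg _

theorem tau_eq_self_iff {n : ℕ} (Z : Siegel n) : tau Z = Z ↔ Z.1.map Complex.re = 0 := by
  rw [Subtype.ext_iff, ← Matrix.ext_iff, ← Matrix.ext_iff]
  refine forall_congr' fun i => forall_congr' fun j => ?_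
  simp only [tau, Matrix.neg_apply, Matrix.map_apply, Matrix.zero_apply, Complex.ext_iff,
    Complex.neg_re, Complex.neg_im, Complex.conj_re, Complex.conj_im, neg_neg, and_true]
  constructor <;> intro h <;> linarith

/-- An element of the congruence subgroup of level four that maps a point of the imaginary cone to
another one is block diagonal. -/
theorem sigma_eq_self_of_tau {n : ℕ} {g : Sp n} (hg : g ∈ Gam n 4) {Z : Siegel n}
    (hZ : tau Z = Z) (hW : tau (g • Z) = g • Z) : sigma g = g := by
  have h : sigma g • Z = g • Z := by
    conv_lhs => rw [← hZ]
    rw [← tau_smul, hW]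
  -- The element `g⁻¹ σ(g)` lies in `Γ(4)` and fixes `Z`, so it is trivial by freeness.
  have h1 := eq_one_of_mem_Gam_four_of_smul_eq ((Gam n 4).mul_mem ((Gam n 4).inv_mem hg)
    (sigma_mem hg)) (Z := Z) (by rw [mul_smul, h, inv_smul_smul])
  exact (inv_mul_eq_one.1 h1).symm

/-- Invariance under `σ` kills `B` and `C`. The symplectic relation then gives `D Aᵀ = 1`, and `CZ +
D` is the unimodular integral matrix `D`. -/
theorem det_den_sq_of_sigma_eq_self {n : ℕ} {g : Sp n} (h : sigma g = g)
    (Z : Matrix (Fin n) (Fin n) ℂ) : ∃ D : ℤ, D * D = 1 ∧ (den g Z).det = D := by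
  have h1 : Matrix.fromBlocks (-1) 0 0 1 * g.1 * Matrix.fromBlocks (-1) 0 0 1 = g.1 :=
    congrArg Subtype.val h
  have hsymp := SymplecticGroup.mem_iff.1 g.2
  obtain ⟨A, B, C, D, hg⟩ : ∃ A B C D, g.1 = Matrix.fromBlocks A B C D :=
    ⟨_, _, _, _, (Matrix.fromBlocks_toBlocks g.1).symm⟩
  rw [hg] at h1 hsymp
  simp only [Matrix.fromBlocks_multiply, Matrix.fromBlocks_inj, neg_mul, one_mul, Matrix.zero_mul,
    add_zero, Matrix.mul_zero, zero_add, mul_neg, mul_one, neg_neg, neg_zero] at h1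
  have hself : ∀ {M : Matrix (Fin n) (Fin n) ℤ}, -M = M → M = 0 := by
    intro M hM
    ext i j
    have := congrFun (congrFun hM i) j
    simp only [Matrix.neg_apply] at this
    simp only [Matrix.zero_apply]
    omega
  have hB : B = 0 := hself h1.2.1
  have hC : C = 0 := hself h1.2.2.1
  rw [hB, hC] at hsymp
  simp only [Matrix.J, Matrix.fromBlocks_transpose, Matrix.fromBlocks_multiply,
    Matrix.fromBlocks_inj, Matrix.transpose_zero, Matrix.mul_zero, Matrix.zero_mul, mul_neg,
    mul_one, add_zero, zero_add, neg_mul, neg_zero] at hsymp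
  have hu : D.det * A.det = 1 := by
    have := congrArg Matrix.det hsymp.2.2.1
    rwa [Matrix.det_mul, Matrix.det_transpose, Matrix.det_one] at this
  refine ⟨D.det, ?_, ?_⟩
  · rcases Int.isUnit_iff.1 (IsUnit.of_mul_eq_one _ hu) with h | h <;> rw [h] <;> rfl
  · have e : den g Z = D.map (Int.castRingHom ℂ) := by
      rw [den, cplx, hg, Matrix.fromBlocks_map, Matrix.toBlocks_fromBlocks₂₁,
        Matrix.toBlocks_fromBlocks₂₂, hC]
      simp
    rw [e, ← RingHom.mapMatrix_apply, ← RingHom.map_det, eq_intCast]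

theorem det_im_smul_of_tau {n : ℕ} {g : Sp n} (hg : g ∈ Gam n 4) {Z : Siegel n}
    (hZ : tau Z = Z) (hW : tau (g • Z) = g • Z) :
    ((g • Z).1.map Complex.im).det = (Z.1.map Complex.im).det := by
  obtain ⟨D, hD, hdet⟩ := det_den_sq_of_sigma_eq_self (sigma_eq_self_of_tau hg hZ hW) Z.1
  have h := congrArg Matrix.det (den_conjTranspose_mul_im_smul_mul_den g Z)
  have e : ∀ M : Matrix (Fin n) (Fin n) ℝ, (M.map Complex.ofReal).det = (M.det : ℂ) := fun M =>
    (RingHom.map_det Complex.ofRealHom M).symm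
  rw [Matrix.det_mul, Matrix.det_mul, Matrix.det_conjTranspose, hdet, e, e] at h
  have h1 : star (D : ℂ) = D := by simp
  have h2 : (D : ℂ) * D = 1 := by exact_mod_cast hD
  rw [h1, mul_comm, mul_assoc, h2, mul_one] at h
  exact_mod_cast h

/-! ## Slices for the action on the Siegel space of degree three -/

theorem isLocallyClosed_siegel : IsLocallyClosed
    {Z : Matrix (Fin 3) (Fin 3) ℂ | Z.IsSymm ∧ (Z.map Complex.im).PosDef} := by
  -- Symmetrizing the imaginary part extends the coordinates continuously to all matrices, so the
  -- half space is an open set intersected with the closed set of symmetric matrices.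
  let y : Matrix (Fin 3) (Fin 3) ℂ → Sym2 (Fin 3) → ℝ := fun Z =>
    Sym2.lift ⟨fun i j => ((Z i j).im + (Z j i).im) / 2, fun i j => by ring⟩
  have hy : Continuous y := by
    refine continuous_pi fun i => ?_
    induction i using Sym2.ind with
    | _ a b =>
      have h : ∀ a b, Continuous fun Z : Matrix (Fin 3) (Fin 3) ℂ => (Z a b).im := fun a b =>
        Complex.continuous_im.comp (continuous_id.matrix_elem a b)
      exact ((h a b).add (h b a)).div_const 2
  have e : {Z : Matrix (Fin 3) (Fin 3) ℂ | Z.IsSymm ∧ (Z.map Complex.im).PosDef} =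
      y ⁻¹' {y | (symMatrix y).PosDef} ∩ {Z | Zᵀ = Z} := by
    ext Z
    have h : Z.IsSymm → symMatrix (y Z) = Z.map Complex.im := by
      intro hZ
      ext i j
      change ((Z i j).im + (Z j i).im) / 2 = (Z i j).im
      rw [hZ.apply i j]; ring
    constructor
    · rintro ⟨h1, h2⟩
      exact ⟨by rwa [Set.mem_preimage, Set.mem_ofPred_eq, h h1], h1⟩
    · rintro ⟨h1, h2⟩
      exact ⟨h2, by rwa [Set.mem_preimage, Set.mem_ofPred_eq, h h2] at h1⟩
  rw [e]
  exact (isOpen_setOf_posDef_symMatrix.preimage hy).isLocallyClosed.inter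
    (isClosed_eq continuous_id.matrix_transpose continuous_id).isLocallyClosed

instance : LocallyCompactSpace (Siegel 3) := by
  have : LocallyCompactSpace (Matrix (Fin 3) (Fin 3) ℂ) :=
    inferInstanceAs (LocallyCompactSpace (Fin 3 → Fin 3 → ℂ))
  exact isLocallyClosed_siegel.locallyCompactSpace

instance {n N : ℕ} : ContinuousConstSMul (Gam n N) (Siegel n) :=
  ⟨fun g => continuous_const_smul g.1⟩

theorem continuousOn_siegel_iff {X : Type*} [TopologicalSpace X] {n : ℕ} {f : X → Siegel n}
    {s : Set X} : ContinuousOn f s ↔ ∀ i j, ContinuousOn (fun x => (f x).1 i j) s := by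
  have h : IsInducing fun Z : Siegel n => Z.1 := ⟨rfl⟩
  rw [h.continuousOn_iff]
  exact continuousOn_pi.trans (forall_congr' fun i => continuousOn_pi)

/-- Proper discontinuity gives a neighbourhood whose self-intersecting translates come from the
stabilizer, and freeness makes those trivial. Intersecting with its preimage under `τ` makes it
`τ`-stable, so that a point of it with real image must be fixed by `τ`. -/
theorem exists_slice {Z₀ : Siegel 3} (hZ₀ : tau Z₀ = Z₀) :
    ∃ U : Set (Siegel 3), IsOpen U ∧ Z₀ ∈ U ∧ (∀ Z ∈ U, tau Z ∈ U) ∧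
      ∀ Z ∈ U, ∀ g ∈ Gam 3 4, g • Z ∈ U → g = 1 := by
  obtain ⟨U, hU, h⟩ :=
    ProperlyDiscontinuousSMul.exists_nhds_image_smul_eq_self (Gam 3 4) Z₀
  refine ⟨interior U ∩ tau ⁻¹' interior U,
    isOpen_interior.inter (isOpen_interior.preimage continuous_tau), ?_, ?_, ?_⟩
  · have := mem_interior_iff_mem_nhds.2 hU
    exact ⟨this, by rwa [Set.mem_preimage, hZ₀]⟩
  · rintro Z ⟨h1, h2⟩
    exact ⟨h2, by rwa [Set.mem_preimage, tau_tau]⟩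
  · rintro Z ⟨h1, -⟩ g hg ⟨h2, -⟩
    exact eq_one_of_mem_Gam_four_of_smul_eq hg
      (h ⟨g, hg⟩ ⟨_, ⟨Z, interior_subset h1, rfl⟩, interior_subset h2⟩)

theorem proj_eq_iff {n N : ℕ} {Z W : Siegel n} :
    proj n N Z = proj n N W ↔ ∃ g ∈ Gam n N, g • W = Z := by
  rw [proj, proj, Quotient.eq]
  constructor
  · rintro ⟨g, hg⟩
    exact ⟨g.1, g.2, hg⟩
  · rintro ⟨g, hg, h⟩
    exact ⟨⟨g, hg⟩, h⟩

theorem proj_mem_realPoints_iff {n N : ℕ} {Z : Siegel n} :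
    proj n N Z ∈ realPoints n N ↔ ∃ g ∈ Gam n N, g • Z = tau Z :=
  proj_eq_iff (Z := tau Z) (W := Z)

theorem proj_mem_realPoints {n N : ℕ} {Z : Siegel n} (h : tau Z = Z) :
    proj n N Z ∈ realPoints n N :=
  proj_mem_realPoints_iff.2 ⟨1, one_mem _, by rw [one_smul, h]⟩

theorem isOpenMap_proj {n N : ℕ} : IsOpenMap (proj n N) :=
  isOpenMap_quotient_mk'_mul

theorem continuous_proj {n N : ℕ} : Continuous (proj n N) :=
  continuous_quot_mk

/-! ## The imaginary cone and its charts -/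

theorem isSymm_I_smul_map {Y : Matrix (Fin 3) (Fin 3) ℝ} (hY : Y.IsSymm) :
    (Complex.I • Y.map Complex.ofReal).IsSymm := by
  refine Matrix.IsSymm.ext fun i j => ?_
  simp [hY.apply i j]

theorem im_I_smul_map (Y : Matrix (Fin 3) (Fin 3) ℝ) :
    (Complex.I • Y.map Complex.ofReal).map Complex.im = Y := by
  ext i j
  simp

open Classical in
/-- The point `i Y` of the Siegel space, where `Y` has coordinates `y`; if `Y` is not positive
definite, the value is the base point `i`. -/
noncomputable def imPoint (y : Sym2 (Fin 3) → ℝ) : Siegel 3 :=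
  if h : (symMatrix y).PosDef then
    ⟨Complex.I • (symMatrix y).map Complex.ofReal, isSymm_I_smul_map (symMatrix_isSymm y),
      by rwa [im_I_smul_map]⟩
  else ⟨Complex.I • (1 : Matrix (Fin 3) (Fin 3) ℝ).map Complex.ofReal,
    isSymm_I_smul_map Matrix.transpose_one, by rw [im_I_smul_map]; exact Matrix.PosDef.one⟩

theorem imPoint_val {y : Sym2 (Fin 3) → ℝ} (h : (symMatrix y).PosDef) :
    (imPoint y).1 = Complex.I • (symMatrix y).map Complex.ofReal := by
  rw [imPoint, dif_pos h]

theorem imPoint_apply {y : Sym2 (Fin 3) → ℝ} (h : (symMatrix y).PosDef) (i j : Fin 3) :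
    (imPoint y).1 i j = Complex.I * (y s(i, j) : ℂ) := by
  rw [imPoint_val h]; rfl

theorem imPart_coords_mk (Z : Siegel 3) (i j : Fin 3) :
    imPart (coords Z) s(i, j) = (Z.1 i j).im := rfl

theorem posDef_imPart_coords (Z : Siegel 3) : (symMatrix (imPart (coords Z))).PosDef := Z.2.2

theorem imPart_coords_imPoint {y : Sym2 (Fin 3) → ℝ} (h : (symMatrix y).PosDef) :
    imPart (coords (imPoint y)) = y := by
  ext i
  induction i using Sym2.ind with
  | _ a b => rw [imPart_coords_mk, imPoint_apply h]; simp

theorem tau_imPoint {y : Sym2 (Fin 3) → ℝ} (h : (symMatrix y).PosDef) :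
    tau (imPoint y) = imPoint y := by
  rw [tau_eq_self_iff]
  ext i j
  rw [Matrix.map_apply, imPoint_apply h]
  simp

theorem imPoint_imPart_coords {Z : Siegel 3} (h : tau Z = Z) :
    imPoint (imPart (coords Z)) = Z := by
  have hp := posDef_imPart_coords Z
  rw [tau_eq_self_iff] at h
  apply Subtype.ext
  ext i j
  have h1 : (Z.1 i j).re = 0 := congrFun (congrFun h i) j
  rw [imPoint_apply hp, imPart_coords_mk]
  apply Complex.ext <;> simp [h1]

theorem continuousOn_imPoint : ContinuousOn imPoint {y | (symMatrix y).PosDef} := by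
  refine continuousOn_siegel_iff.2 fun i j => ?_
  have h : Continuous fun y : Sym2 (Fin 3) → ℝ => Complex.I * (y s(i, j) : ℂ) := by fun_prop
  exact h.continuousOn.congr fun y hy => imPoint_apply hy i j

theorem continuous_imPart_coords : Continuous fun Z : Siegel 3 => imPart (coords Z) := by
  refine continuous_pi fun i => ?_
  induction i using Sym2.ind with
  | _ a b => exact Complex.continuous_im.comp (continuous_val_siegel.matrix_elem a b)

/-- The coordinates of the symmetric matrix of determinant `c + v₀` whose remaining independent
entries are `v₁, …, v₅`. -/
noncomputable def chartCoords (c : ℝ) (v : Fin 6 → ℝ) : Sym2 (Fin 3) → ℝ :=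
  Sym2.lift ⟨fun i j => (!![v 1, v 2, v 3; v 2, v 4, v 5; v 3, v 5,
    (c + v 0 - (2 * v 2 * v 3 * v 5 - v 1 * v 5 ^ 2 - v 4 * v 3 ^ 2)) / (v 1 * v 4 - v 2 ^ 2)] :
      Matrix (Fin 3) (Fin 3) ℝ) i j, fun i j => by fin_cases i <;> fin_cases j <;> rfl⟩

/-- The inverse of `chartCoords`. -/
def chartInv (c : ℝ) (y : Sym2 (Fin 3) → ℝ) : Fin 6 → ℝ :=
  ![nrm y - c, y s(0, 0), y s(0, 1), y s(0, 2), y s(1, 1), y s(1, 2)]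

/-- The domain of `chartCoords`. -/
def chartDomain (c : ℝ) : Set (Fin 6 → ℝ) :=
  {v | 0 < v 1 ∧ 0 < v 1 * v 4 - v 2 ^ 2 ∧ 0 < c + v 0}

theorem isOpen_chartDomain (c : ℝ) : IsOpen (chartDomain c) := by
  have h1 : Continuous fun v : Fin 6 → ℝ => v 1 := by fun_prop
  have h2 : Continuous fun v : Fin 6 → ℝ => v 1 * v 4 - v 2 ^ 2 := by fun_prop
  have h3 : Continuous fun v : Fin 6 → ℝ => c + v 0 := by fun_prop
  exact (isOpen_lt continuous_const h1).inter
    ((isOpen_lt continuous_const h2).inter (isOpen_lt continuous_const h3))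

/-- The determinant is affine in the last diagonal entry, with the leading `2 × 2` minor as slope;
the chart solves for that entry. -/
theorem nrm_chartCoords {c : ℝ} {v : Fin 6 → ℝ} (hv : v ∈ chartDomain c) :
    nrm (chartCoords c v) = c + v 0 := by
  have h : v 1 * v 4 - v 2 ^ 2 ≠ 0 := hv.2.1.ne'
  simp [nrm, chartCoords]
  field_simp
  ring

theorem posDef_chartCoords {c : ℝ} {v : Fin 6 → ℝ} (hv : v ∈ chartDomain c) :
    (symMatrix (chartCoords c v)).PosDef :=
  (posDef_symMatrix_iff _).2 ⟨hv.1, hv.2.1, by rw [nrm_chartCoords hv]; exact hv.2.2⟩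

theorem chartInv_chartCoords {c : ℝ} {v : Fin 6 → ℝ} (hv : v ∈ chartDomain c) :
    chartInv c (chartCoords c v) = v := by
  ext i
  fin_cases i
  · simp [chartInv, nrm_chartCoords hv]
  all_goals rfl

theorem chartInv_mem {c : ℝ} {y : Sym2 (Fin 3) → ℝ} (hy : (symMatrix y).PosDef) :
    chartInv c y ∈ chartDomain c := by
  obtain ⟨h1, h2, h3⟩ := (posDef_symMatrix_iff y).1 hy
  exact ⟨h1, h2, by simpa [chartInv] using h3⟩

theorem chartCoords_chartInv {c : ℝ} {y : Sym2 (Fin 3) → ℝ} (hy : (symMatrix y).PosDef) :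
    chartCoords c (chartInv c y) = y := by
  have h := ((posDef_symMatrix_iff y).1 hy).2.1.ne'
  ext i
  induction i using sym2_fin_three_cases
  case h22 =>
    simp [chartCoords, chartInv, nrm]
    field_simp
    ring
  all_goals rfl

theorem continuous_chartInv (c : ℝ) : Continuous (chartInv c) := by
  refine continuous_pi fun i => ?_
  fin_cases i <;> simp [chartInv, nrm] <;> fun_prop

theorem differentiable_chartInv (c : ℝ) : Differentiable ℝ (chartInv c) := by
  refine differentiable_pi.2 fun i => ?_
  fin_cases i <;> simp [chartInv, nrm] <;> fun_prop

theorem contDiffOn_chartCoords (c : ℝ) (i : Sym2 (Fin 3)) :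
    ContDiffOn ℝ ∞ (fun v => chartCoords c v i) (chartDomain c) := by
  induction i using sym2_fin_three_cases
  case h22 =>
    have h1 : ContDiff ℝ ∞ fun v : Fin 6 → ℝ =>
      c + v 0 - (2 * v 2 * v 3 * v 5 - v 1 * v 5 ^ 2 - v 4 * v 3 ^ 2) := by fun_prop
    have h2 : ContDiff ℝ ∞ fun v : Fin 6 → ℝ => v 1 * v 4 - v 2 ^ 2 := by fun_prop
    exact h1.contDiffOn.div h2.contDiffOn fun v hv => hv.2.1.ne'
  all_goals exact ContDiff.contDiffOn (contDiff_apply ℝ ℝ _)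

/-- The parametrization of the imaginary cone. -/
noncomputable def chartMap (c : ℝ) (v : Fin 6 → ℝ) : Siegel 3 := imPoint (chartCoords c v)

theorem contDiffOn_chartMap (c : ℝ) (i j : Fin 3) :
    ContDiffOn ℝ ∞ (fun v => (chartMap c v).1 i j) (chartDomain c) := by
  have h : ContDiffOn ℝ ∞ (fun v => Complex.I * Complex.ofRealCLM (chartCoords c v s(i, j)))
      (chartDomain c) :=
    contDiffOn_const.mul (Complex.ofRealCLM.contDiff.comp_contDiffOn (contDiffOn_chartCoords c _))
  exact h.congr fun v hv => imPoint_apply (posDef_chartCoords hv) i j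

theorem continuousOn_chartMap (c : ℝ) : ContinuousOn (chartMap c) (chartDomain c) := by
  exact continuousOn_siegel_iff.2 fun i j => (contDiffOn_chartMap c i j).continuousOn

theorem chartInv_chartMap {c : ℝ} {v : Fin 6 → ℝ} (hv : v ∈ chartDomain c) :
    chartInv c (imPart (coords (chartMap c v))) = v := by
  rw [chartMap, imPart_coords_imPoint (posDef_chartCoords hv), chartInv_chartCoords hv]

theorem chartMap_chartInv {c : ℝ} {Z : Siegel 3} (h : tau Z = Z) :
    chartMap c (chartInv c (imPart (coords Z))) = Z := by
  rw [chartMap, chartCoords_chartInv (posDef_imPart_coords Z), imPoint_imPart_coords h]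

theorem tau_chartMap {c : ℝ} {v : Fin 6 → ℝ} (hv : v ∈ chartDomain c) :
    tau (chartMap c v) = chartMap c v :=
  tau_imPoint (posDef_chartCoords hv)

/-- The parametrization has a differentiable left inverse. Along the line `v + h w`, the chain rule
computes `w` as the image of `0`. -/
theorem chartMap_immersion {c : ℝ} {v : Fin 6 → ℝ} (hv : v ∈ chartDomain c) {w : Fin 6 → ℝ}
    (hw : ∀ i j, fderiv ℝ (fun v => (chartMap c v).1 i j) v w = 0) : w = 0 := by
  have hline : HasDerivAt (fun h : ℝ => v + h • w) w 0 := by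
    simpa using ((hasDerivAt_id (0 : ℝ)).smul_const w).const_add v
  have hdom : ∀ᶠ h : ℝ in 𝓝 0, v + h • w ∈ chartDomain c :=
    hline.continuousAt.eventually_mem ((isOpen_chartDomain c).mem_nhds (by simpa using hv))
  have hY : HasDerivAt (fun h : ℝ => imPart (coords (chartMap c (v + h • w)))) 0 0 := by
    refine hasDerivAt_pi.2 fun i => ?_
    induction i using Sym2.ind with
    | _ a b =>
      have h1 : HasFDerivAt (fun v => (chartMap c v).1 a b)
          (fderiv ℝ (fun v => (chartMap c v).1 a b) v) (v + (0 : ℝ) • w) := by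
        rw [zero_smul, add_zero]
        exact ((((contDiffOn_chartMap c a b).contDiffAt
          ((isOpen_chartDomain c).mem_nhds hv)).differentiableAt (by simp))).hasFDerivAt
      have h2 := h1.comp_hasDerivAt (0 : ℝ) hline
      rw [hw a b] at h2
      have h3 := Complex.imCLM.hasFDerivAt.comp_hasDerivAt (0 : ℝ) h2
      rw [map_zero] at h3
      exact h3
  have h1 := ((differentiable_chartInv c)
    (imPart (coords (chartMap c (v + (0 : ℝ) • w))))).hasFDerivAt.comp_hasDerivAt (0 : ℝ) hY
  rw [map_zero] at h1
  refine (hline.congr_of_eventuallyEq ?_).unique h1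
  filter_upwards [hdom] with h hh
  exact chartInv_chartMap hh

/-! ## The image of the attractor locus in the moduli of real abelian threefolds -/

theorem tau_of_mem_locusC {p0 q0 : ℝ} {Z : Siegel 3} (h : Z ∈ locusC p0 q0) : tau Z = Z :=
  (tau_eq_self_iff Z).2 h.1

theorem nrm_of_mem_locusC {p0 q0 : ℝ} {Z : Siegel 3} (h : Z ∈ locusC p0 q0) :
    nrm (imPart (coords Z)) = |q0 / p0| := by
  rw [← det_symMatrix]; exact h.2

theorem mem_locusC_of_tau {p0 q0 : ℝ} {Z : Siegel 3} (h : tau Z = Z)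
    (hZ : nrm (imPart (coords Z)) = |q0 / p0|) : Z ∈ locusC p0 q0 :=
  ⟨(tau_eq_self_iff Z).1 h, by rw [← hZ, ← det_symMatrix]; rfl⟩

/-- Injectivity holds because `U` meets no nontrivial translate of itself. For openness, an open
subset of the parameters corresponds to an open subset of `U`, not only of the cone, whose image in
`X(4)` is open and meets the real locus exactly in the image of the chart. -/
theorem isOpenEmbedding_chart {c : ℝ} {U : Set (Siegel 3)} (hU : IsOpen U)
    (hUτ : ∀ Z ∈ U, tau Z ∈ U) (hUg : ∀ Z ∈ U, ∀ g ∈ Gam 3 4, g • Z ∈ U → g = 1)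
    {V : Set (Fin 6 → ℝ)} (hV : V = chartDomain c ∩ chartMap c ⁻¹' U)
    (hS : ∀ v ∈ V, proj 3 4 (chartMap c v) ∈ realPoints 3 4) :
    IsOpenEmbedding
      (fun v : V => (⟨proj 3 4 (chartMap c v), hS v v.2⟩ : realPoints 3 4)) := by
  subst hV
  refine .of_continuous_injective_isOpenMap ?_ ?_ ?_
  · refine Continuous.subtype_mk (continuous_proj.comp ?_) _
    exact ((continuousOn_chartMap c).mono Set.inter_subset_left).domRestrict
  · rintro ⟨v, hv, hvU⟩ ⟨w, hw, hwU⟩ h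
    obtain ⟨g, hg, hgw⟩ := proj_eq_iff.1 (congrArg Subtype.val h)
    have h1 := hUg _ hwU g hg (by rw [hgw]; exact hvU)
    rw [h1, one_smul] at hgw
    have h2 : v = w := by rw [← chartInv_chartMap hv, ← chartInv_chartMap hw, hgw]
    exact Subtype.ext h2
  · intro O hO
    obtain ⟨O', hO', rfl⟩ := isOpen_induced_iff.1 hO
    have hopen : IsOpen (U ∩ (fun Z => chartInv c (imPart (coords Z))) ⁻¹' O') :=
      hU.inter (hO'.preimage ((continuous_chartInv c).comp continuous_imPart_coords))
    refine isOpen_induced_iff.2 ⟨_, isOpenMap_proj _ hopen, ?_⟩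
    ext ⟨x, hx⟩
    constructor
    · rintro ⟨Z, ⟨hZU, hZO⟩, hZx⟩
      have hZx' : proj 3 4 Z = x := hZx
      subst hZx'
      -- Both `Z` and `gZ = τZ` lie in `U`, so `g = 1` and `Z` belongs to the cone.
      obtain ⟨g, hg, hgZ⟩ := proj_mem_realPoints_iff.1 hx
      have h1 := hUg Z hZU g hg (by rw [hgZ]; exact hUτ Z hZU)
      rw [h1, one_smul] at hgZ
      have h2 := chartMap_chartInv (c := c) hgZ.symm
      refine ⟨⟨chartInv c (imPart (coords Z)), chartInv_mem (posDef_imPart_coords Z), ?_⟩, hZO, ?_⟩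
      · rwa [Set.mem_preimage, h2]
      · exact Subtype.ext (congrArg (proj 3 4) h2)
    · rintro ⟨⟨v, hv, hvU⟩, hvO, hvx⟩
      refine ⟨chartMap c v, ⟨hvU, ?_⟩, congrArg Subtype.val hvx⟩
      rw [Set.mem_preimage, chartInv_chartMap hv]
      exact hvO

theorem isSmoothHypersurface_locusC (p0 q0 : ℝ) :
    IsSmoothHypersurface 6 (proj 3 4 '' locusC p0 q0) (realPoints 3 4) := by
  refine ⟨?_, ?_⟩
  · rintro _ ⟨Z, hZ, rfl⟩
    exact proj_mem_realPoints (tau_of_mem_locusC hZ)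
  · rintro _ ⟨Z₀, hZ₀, rfl⟩
    have hτ := tau_of_mem_locusC hZ₀
    obtain ⟨U, hU, hZU, hUτ, hUg⟩ := exists_slice hτ
    set c := |q0 / p0| with hc
    have hS : ∀ v ∈ chartDomain c ∩ chartMap c ⁻¹' U,
        proj 3 4 (chartMap c v) ∈ realPoints 3 4 := fun v hv =>
      proj_mem_realPoints (tau_chartMap hv.1)
    refine ⟨chartDomain c ∩ chartMap c ⁻¹' U, chartMap c, hS,
      (continuousOn_chartMap c).isOpen_inter_preimage (isOpen_chartDomain c) hU,
      fun i j => (contDiffOn_chartMap c i j).mono Set.inter_subset_left,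
      fun v hv w hw => chartMap_immersion hv.1 hw, isOpenEmbedding_chart hU hUτ hUg rfl hS,
      ⟨chartInv c (imPart (coords Z₀)), ⟨chartInv_mem (posDef_imPart_coords Z₀), ?_⟩, ?_⟩,
      fun v hv => ?_⟩
    · rwa [Set.mem_preimage, chartMap_chartInv hτ]
    · rw [chartMap_chartInv hτ]
    · have hn : nrm (imPart (coords (chartMap c v))) = c + v 0 := by
        rw [chartMap, imPart_coords_imPoint (posDef_chartCoords hv.1), nrm_chartCoords hv.1]
      have hvτ := tau_chartMap hv.1
      constructor
      -- The representative `Z` in `C_Q` may lie outside `U`; it is related to the chart point by an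
      -- element of `Γ(4)`, which preserves `det Y`.
      · rintro ⟨Z, hZ, hZv⟩
        obtain ⟨g, hg, hgv⟩ := proj_eq_iff.1 hZv
        have h1 := det_im_smul_of_tau hg hvτ (by rw [hgv]; exact tau_of_mem_locusC hZ)
        rw [hgv, ← symMatrix_imPart_coords, ← symMatrix_imPart_coords, det_symMatrix,
          det_symMatrix, hn, nrm_of_mem_locusC hZ, ← hc] at h1
        linarith
      · intro h0
        exact ⟨_, mem_locusC_of_tau hvτ (by rw [hn, h0, add_zero]), rfl⟩

/-! ### Connectedness of the attractor locus -/

theorem isPreconnected_setOf_posDef_symMatrix :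
    IsPreconnected {y : Sym2 (Fin 3) → ℝ | (symMatrix y).PosDef} := by
  refine Convex.isPreconnected fun x hx y hy a b ha hb hab => ?_
  have hxy : symMatrix (a • x + b • y) = a • symMatrix x + b • symMatrix y := rfl
  change (symMatrix (a • x + b • y)).PosDef
  rw [hxy]
  rcases ha.eq_or_lt with rfl | ha
  · have hb1 : b = 1 := by linarith
    rw [hb1, zero_smul, zero_add, one_smul]
    exact hy
  · exact (Matrix.PosDef.smul hx ha).add_posSemidef (Matrix.PosSemidef.smul hy.posSemidef hb)

/-- The radial projection of the positive cone to the hypersurface `det = c`. -/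
noncomputable def radial (c : ℝ) (y : Sym2 (Fin 3) → ℝ) : Sym2 (Fin 3) → ℝ :=
  fun i => (c / nrm y) ^ (3⁻¹ : ℝ) * y i

theorem nrm_radial {c : ℝ} (hc : 0 < c) {y : Sym2 (Fin 3) → ℝ} (hy : 0 < nrm y) :
    nrm (radial c y) = c := by
  have h : 0 ≤ c / nrm y := by positivity
  unfold radial
  rw [nrm_smul, ← Real.rpow_natCast, ← Real.rpow_mul h]
  norm_num
  field_simp

theorem radial_of_nrm_eq {c : ℝ} (hc : 0 < c) {y : Sym2 (Fin 3) → ℝ} (hy : nrm y = c) :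
    radial c y = y := by
  ext i
  rw [radial, hy, div_self hc.ne', Real.one_rpow, one_mul]

theorem posDef_radial {c : ℝ} (hc : 0 < c) {y : Sym2 (Fin 3) → ℝ} (hy : (symMatrix y).PosDef) :
    (symMatrix (radial c y)).PosDef := by
  have hn : 0 < nrm y := ((posDef_symMatrix_iff y).1 hy).2.2
  exact Matrix.PosDef.smul hy (Real.rpow_pos_of_pos (div_pos hc hn) _)

theorem continuousOn_radial {c : ℝ} (hc : 0 < c) :
    ContinuousOn (radial c) {y | (symMatrix y).PosDef} := by
  have hn : Continuous (nrm : (Sym2 (Fin 3) → ℝ) → ℝ) := by unfold nrm; fun_prop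
  have h0 : ∀ y ∈ {y : Sym2 (Fin 3) → ℝ | (symMatrix y).PosDef}, 0 < nrm y := fun y hy =>
    ((posDef_symMatrix_iff y).1 hy).2.2
  refine continuousOn_pi.2 fun i => ContinuousOn.mul ?_ (continuous_apply i).continuousOn
  exact (continuousOn_const.div hn.continuousOn fun y hy => (h0 y hy).ne').rpow_const fun y hy =>
    Or.inl (div_pos hc (h0 y hy)).ne'

/-- Radial projection fixes the hypersurface `det Y = c` pointwise, so `C_Q` inherits connectedness
from the convex cone. -/
theorem locusC_eq_image {p0 q0 : ℝ} (h : 0 < |q0 / p0|) :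
    locusC p0 q0 = (fun y => imPoint (radial |q0 / p0| y)) '' {y | (symMatrix y).PosDef} := by
  ext Z
  constructor
  · intro hZ
    refine ⟨imPart (coords Z), Z.2.2, ?_⟩
    change imPoint (radial _ _) = Z
    rw [radial_of_nrm_eq h (nrm_of_mem_locusC hZ), imPoint_imPart_coords (tau_of_mem_locusC hZ)]
  · rintro ⟨y, hy, rfl⟩
    have hp := posDef_radial h hy
    refine mem_locusC_of_tau (tau_imPoint hp) ?_
    rw [imPart_coords_imPoint hp, nrm_radial h ((posDef_symMatrix_iff y).1 hy).2.2]

theorem isConnected_locusC {p0 q0 : ℝ} (h : 0 < |q0 / p0|) : IsConnected (locusC p0 q0) := by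
  rw [locusC_eq_image h]
  refine ⟨?_, isPreconnected_setOf_posDef_symMatrix.image _
    (continuousOn_imPoint.comp (continuousOn_radial h) fun y hy => posDef_radial h hy)⟩
  obtain ⟨t, ht⟩ := exists_symMatrix (M := (1 : Matrix (Fin 3) (Fin 3) ℝ)) Matrix.transpose_one
  exact ⟨_, t, by rw [Set.mem_ofPred_eq, ht]; exact Matrix.PosDef.one, rfl⟩

theorem mainTheorem10 (p0 q0 : ℝ) (hp0 : p0 ≠ 0) (hq0 : q0 ≠ 0) :
    -- the attractor locus of the non-BPS charge `Q = (p^0, 0, q_0, 0)` is `C_Q`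
    attractorLocus (chargeD0D6 p0 q0) = locusC p0 q0 ∧
    -- its image in `X(4)` is a hypersurface in the six-dimensional moduli `X(4)(ℝ)`
    IsSmoothHypersurface 6 (proj 3 4 '' locusC p0 q0) (realPoints 3 4) ∧
    -- its image in `X(1)` lies in one connected component of the image of `X(4)(ℝ)`
    ∃ x ∈ forget 3 4 '' realPoints 3 4,
      proj 3 1 '' locusC p0 q0 ⊆ connectedComponentIn (forget 3 4 '' realPoints 3 4) x := by
  refine ⟨attractorLocus_chargeD0D6 hp0 hq0, isSmoothHypersurface_locusC p0 q0, ?_⟩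
  have hconn := (isConnected_locusC (abs_pos.2 (div_ne_zero hq0 hp0))).image (proj 3 1)
    continuous_proj.continuousOn
  have hsub : proj 3 1 '' locusC p0 q0 ⊆ forget 3 4 '' realPoints 3 4 := by
    rintro _ ⟨Z, hZ, rfl⟩
    exact ⟨proj 3 4 Z, proj_mem_realPoints (tau_of_mem_locusC hZ), rfl⟩
  obtain ⟨x, hx⟩ := hconn.nonempty
  exact ⟨x, hsub hx, hconn.isPreconnected.subset_connectedComponentIn hx hsub⟩
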